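/- Let $\varphi$ be the even solution of $\ddot\varphi+\varphi-\varphi^3=0$ with fundamental period $6\pi$ and $0<\varphi(0)<1$, and let $c_3(6\pi)=\frac1{3\pi}\int_0^{6\pi}\varphi(\tau)\cos\tau\,d\tau$; assume $c_3(6\pi)\neq0$. Let $\delta\neq0$ be fixed and let $a=a(\delta)\in\mathbb R$ satisfy $2\delta a+\frac34a^3+c_3(6\pi)=0$ and $8\delta+9a^2\neq0$. For $\epsilon>0$ put $$\beta=1-\frac{1+2\epsilon}{(1+\delta\epsilon^{2/3})^2},\qquad \gamma=\frac{\epsilon}{(1+\delta\epsilon^{2/3})^2},\qquad \nu=2\gamma\epsilon^{1/3}a,$$ and consider the rescaled Klein--Gordon lattice $$\ddot U_n+U_n-U_n^3=\beta U_n+\gamma(U_{n+1}+U_{n-1}),\qquad n\in\mathbb Z. \tag{1}$$ Norms are those of $H^2_{\rm per}=H^2_{\rm per}(0,6\pi)$, $\|f\|^2=\sum_{m\in\mathbb Z}(1+m^2)^2|\hat f_m|^2$ with $f(\tau)=\sum_{m}\hat f_m e^{im\tau/3}$. There is a map $(\epsilon,U_0)\mapsto R_\epsilon(U_0)$, defining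 the perturbed Duffing equation $$\ddot U_0+U_0-U_0^3=\beta U_0+\nu\cos\tau+R_\epsilon(U_0), \tag{2}$$ such that for every $K>0$ there are $\epsilon_0>0$ and $C>0$ with the following property. Let $0<\epsilon<\epsilon_0$ and let $U_0\in H^2_{\rm per}$ satisfy $U_0(-\tau)=U_0(\tau)=-U_0(3\pi-\tau)$ for all $\tau\in\mathbb R$ and $\|U_0-\varphi\|\le K\epsilon^{2/3}$. Then $\|R_\epsilon(U_0)\|\le C\epsilon^{5/3}$, and there are even functions $U_n\in H^2_{\rm per}$, $n\in\mathbb Z\setminus\{0\}$, with $U_{-n}=U_n$ and $\sum_n\|U_n\|^2<\infty$, which together with $U_0$ satisfy (1) for all $n\neq0$ and $2\gamma U_1=\nu\cos\tau+R_\epsilon(U_0)$, and $$\Big\|U_{\pm1}-\epsilon^{1/3}a\cos\tau-\epsilon^{2/3}\tfrac{8a}{8\delta+9a^2}\cos\tau\Big\|\le C\epsilon,\qquad \Big\|U_{\pm2}+\epsilon^{2/3}\tfrac{a}{2\delta}\cos\tau\Big\|\le C\epsilon,\qquad \|U_{\pm n}\|\le C\epsilon\quad(n\ge3).$$ The sequence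 $(U_n)_{n\in\mathbb Z}$ solves (1) at all sites $n\in\mathbb Z$ if and only if $U_0$ solves (2). In particular, every $6\pi$-periodic solution $U_0$ of (2) with these symmetries and with $\|U_0-\varphi\|\le K\epsilon^{2/3}$ is the central component of a solution of the lattice (1) with the above asymptotics. -/

import Mathlib

open Real

noncomputable section

/-- The `m`-th complex Fourier coefficient of a `6π`-periodic function,
`c_m = (1 / 6π) ∫_0^{6π} f(t) exp(-i m t / 3) dt`. -/
def perFourierCoeff (f : ℝ → ℝ) (m : ℤ) : ℂ :=
  fourierCoeffOn (a := 0) (b := 6 * π) (by positivity) (fun t => (f t : ℂ)) m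

/-- Membership in `H²_per(0, 6π)`; elements are identified with their continuous
representatives on the real line. -/
def MemH2per (f : ℝ → ℝ) : Prop :=
  Function.Periodic f (6 * π) ∧ Continuous f ∧
    Summable fun m : ℤ => (1 + (m : ℝ) ^ 2) ^ 2 * ‖perFourierCoeff f m‖ ^ 2

/-- The norm of `H²_per(0, 6π)`, `(∑_m (1 + m²)² |c_m|²)^{1/2}`
(meaningful for functions in that space). -/
def normH2per (f : ℝ → ℝ) : ℝ :=
  √(∑' m : ℤ, (1 + (m : ℝ) ^ 2) ^ 2 * ‖perFourierCoeff f m‖ ^ 2)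

/-- `f` lies in `H²_per(0, 6π)` and its norm there is at most `M`. -/
def H2perLe (f : ℝ → ℝ) (M : ℝ) : Prop :=
  MemH2per f ∧ normH2per f ≤ M

/-- `φ` is the even oscillation, of fundamental period `6π`, of the nonlinear oscillator
`φ'' + V'(φ) = 0`, `V(u) = u² / 2 - u⁴ / 4`, started inside the potential well at its positive
turning point `φ(0) ∈ (0, 1)`. -/
structure IsOscillation (φ : ℝ → ℝ) : Prop where
  contDiff : ContDiff ℝ 2 φ
  ode : ∀ t, deriv (deriv φ) t + φ t - φ t ^ 3 = 0
  even : ∀ t, φ (-t) = φ t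
  initial : 0 < φ 0 ∧ φ 0 < 1
  periodic : Function.Periodic φ (6 * π)
  minimal : ∀ T, 0 < T → T < 6 * π → ¬ Function.Periodic φ T

/-- The coefficient of `cos τ` in the Fourier series `∑_{n odd} c_n cos (n τ / 3)`. -/
def thirdCoeff (φ : ℝ → ℝ) : ℝ :=
  (1 / (3 * π)) * ∫ τ in (0 : ℝ)..(6 * π), φ τ * cos τ

def kgBeta (δ ε : ℝ) : ℝ :=
  1 - (1 + 2 * ε) / (1 + δ * ε ^ (2 / 3 : ℝ)) ^ 2

def kgGamma (δ ε : ℝ) : ℝ :=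
  ε / (1 + δ * ε ^ (2 / 3 : ℝ)) ^ 2

def kgNu (δ a ε : ℝ) : ℝ :=
  2 * kgGamma δ ε * ε ^ (1 / 3 : ℝ) * a

/-- The rescaled Klein–Gordon equation at the site `n`, in the classical sense. -/
def KGAt (δ ε : ℝ) (U : ℤ → ℝ → ℝ) (n : ℤ) : Prop :=
  ContDiff ℝ 2 (U n) ∧ ∀ τ,
    deriv (deriv (U n)) τ + U n τ - U n τ ^ 3 =
      kgBeta δ ε * U n τ + kgGamma δ ε * (U (n + 1) τ + U (n - 1) τ)

/-- `U` solves the rescaled Klein–Gordon lattice equation at all sites. -/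
def IsKGSolution (δ ε : ℝ) (U : ℤ → ℝ → ℝ) : Prop :=
  ∀ n : ℤ, KGAt δ ε U n

/-- `U` belongs to `l²(ℤ, H²_e(0, 6π))`, where the index `e` means even functions. -/
def MemL2H2e (U : ℤ → ℝ → ℝ) : Prop :=
  (∀ n, MemH2per (U n)) ∧ (∀ n τ, U n (-τ) = U n τ) ∧ Summable fun n => normH2per (U n) ^ 2

/-- The Duffing equation with harmonic forcing and a remainder `r`:
`U₀'' + U₀ - U₀³ = β U₀ + ν cos τ + r`. -/
def SolvesDuffing (δ a ε : ℝ) (r U₀ : ℝ → ℝ) : Prop :=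
  ContDiff ℝ 2 U₀ ∧ ∀ τ,
    deriv (deriv U₀) τ + U₀ τ - U₀ τ ^ 3 = kgBeta δ ε * U₀ τ + kgNu δ a ε * cos τ + r τ

/-- The symmetries `U₀(-τ) = U₀(τ) = -U₀(3π - τ)`. -/
def IsSymmetric (U₀ : ℝ → ℝ) : Prop :=
  ∀ τ, U₀ (-τ) = U₀ τ ∧ U₀ τ = -U₀ (3 * π - τ)

/-- The asymptotic form of the sites `n ≠ 0`, with remainders of `H²_per`-norm at most `C ε`. -/
def HasExpansion (δ a ε C : ℝ) (U : ℤ → ℝ → ℝ) : Prop :=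
  (∀ n : ℤ, |n| = 1 → H2perLe
    (fun τ => U n τ - (ε ^ (1 / 3 : ℝ) * a * cos τ +
      ε ^ (2 / 3 : ℝ) * (8 * a / (8 * δ + 9 * a ^ 2)) * cos τ)) (C * ε)) ∧
  (∀ n : ℤ, |n| = 2 → H2perLe
    (fun τ => U n τ - (-(ε ^ (2 / 3 : ℝ) * (a / (2 * δ)) * cos τ))) (C * ε)) ∧
  (∀ n : ℤ, 3 ≤ |n| → H2perLe (U n) (C * ε))

end

/-! Put μ = ε^{1/3}, so that β = μ²(2δ − 2μ + O(μ²)) and γ = μ³(1 + O(μ²)). Once U₀ is prescribed,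
the sites n > 0 and n < 0 decouple; it suffices to solve for n ≥ 1 and reflect. Then R is defined as
2γU₁ − ν cos τ, which makes the lattice equation at site 0 literally the Duffing equation.

At each n ≥ 1 the equation reads U'' + U = F, with F = βU + U³ + γ(neighbours), and the even kernel
of the left side is spanned by cos. By Lyapunov–Schmidt, the non-resonant part of U is a partial
inverse applied to F, and the cos-coefficient of F must vanish. Insert U₁ ≈ (μa + μ²b) cos and U₂ ≈
μ²b' cos. At site 1 this solvability condition is the cubic for a at order μ³ and a linear equation
for b at order μ⁴; at site 2 it is a linear equation for b' at order μ⁴. The remaining force has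
norm O(μ³) but cos-coefficient only O(μ⁵) (`exists_residual_bound`).

To leading order the derivative of the condition in the cos-amplitude is μ²(2δ + 9a²/4) at site 1
and 2δμ² elsewhere, hence invertible. Dividing μ⁵ by μ² shows that both components of the correction
have size μ³. A contraction finds it (`exists_force_sub`, `exists_halfLattice_solution`); the
weights 2⁻ⁿ give square summability over the sites.

The contraction runs in the uniform norm. The Sobolev embedding `MemH2per.abs_le` converts the
hypothesis on U₀, and the differential equation converts uniform bounds back into H² bounds
(`H2perLe_of_hasDerivAt`). Since R must not depend on K, `exists_extension_selection` fixes one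
extension for each pair (ε, U₀). -/

noncomputable section

/-! ### Abstract fixed point, approximate solution and its residual. -/

/-- A contraction on the sequences bounded by `ρ` has a fixed point there. -/
theorem exists_fixed_seq {X : Type*} [NormedAddCommGroup X] [CompleteSpace X]
    (F : (ℕ → X) → ℕ → X) {ρ : ℝ} (hρ : 0 ≤ ρ)
    (hF : ∀ V V' : ℕ → X, ∀ D : ℝ, (∀ m, ‖V m‖ ≤ ρ) → (∀ m, ‖V' m‖ ≤ ρ) →
      (∀ m, ‖V m - V' m‖ ≤ D) → ∀ n, ‖F V n - F V' n‖ ≤ D / 2)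
    (h0 : ∀ n, ‖F 0 n‖ ≤ ρ / 2) :
    ∃ V : ℕ → X, (∀ m, ‖V m‖ ≤ ρ) ∧ F V = V := by
  have hb : ∀ V : ℕ → X, (∀ m, ‖V m‖ ≤ ρ) → ∀ n, ‖F V n‖ ≤ ρ := fun V hV n => by
    -- Comparison with the zero sequence: ρ/2 from the Lipschitz bound plus ρ/2 from `h0` keeps the
    -- ball invariant.
    have h1 := hF V 0 ρ hV (by simpa using hρ) (by simpa using hV) n
    have h2 := norm_le_norm_add_norm_sub (F 0 n) (F V n)
    rw [norm_sub_rev] at h2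
    linarith [h0 n]
  let S := Metric.closedBall (0 : BoundedContinuousFunction ℕ X) ρ
  have hS : ∀ V : S, ∀ m, ‖V.1 m‖ ≤ ρ := fun V m =>
    (V.1.norm_coe_le_norm m).trans (mem_closedBall_zero_iff.1 V.2)
  let G : S → S := fun V => ⟨BoundedContinuousFunction.ofNormedAddCommGroupDiscrete (F V.1) ρ
      (hb _ (hS V)), mem_closedBall_zero_iff.2
        ((BoundedContinuousFunction.norm_le hρ).2 (hb _ (hS V)))⟩
  have hG : ContractingWith (1 / 2) G := by
    refine ⟨by norm_num, LipschitzWith.of_dist_le_mul fun V V' => ?_⟩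
    rw [Subtype.dist_eq, BoundedContinuousFunction.dist_le (by positivity)]
    intro n
    have := hF V.1 V'.1 (dist V V') (hS V) (hS V') (fun m => by
      rw [← dist_eq_norm]; exact BoundedContinuousFunction.dist_coe_le_dist m) n
    rw [dist_eq_norm]
    calc _ ≤ _ := this
      _ = _ := by push_cast; ring
  have : Nonempty S := ⟨⟨0, Metric.mem_closedBall_self hρ⟩⟩
  have : CompleteSpace S := Metric.isClosed_closedBall.completeSpace_coe
  refine ⟨(ContractingWith.fixedPoint G hG).1, hS _, ?_⟩
  have := congrArg (fun V : S => (V.1 : ℕ → X)) (hG.fixedPoint_isFixedPt)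
  exact this

/-- The right-hand side of the lattice equation at the site `n`, with `β u + u³` included. -/
def siteForce {X : Type*} [NormedCommRing X] [NormedAlgebra ℝ X] (β γ : ℝ) (U : ℕ → X) (n : ℕ) :
    X :=
  β • U n + U n ^ 3 + γ • (U (n + 1) + U (n - 1))

/-- The amplitude of order `μ` of the approximate solution. -/
def amp (a : ℝ) (n : ℕ) : ℝ := if n = 1 then a else 0

/-- The amplitude of order `μ²` of the approximate solution. -/
def ampCorr (δ a : ℝ) (n : ℕ) : ℝ :=
  if n = 1 then 8 * a / (8 * δ + 9 * a ^ 2) else if n = 2 then -(a / (2 * δ)) else 0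

/-- The approximate solution of the lattice equation. -/
def approxSol {X : Type*} [NormedCommRing X] [NormedAlgebra ℝ X] (δ a μ : ℝ) (e u₀ : X) (n : ℕ) :
    X :=
  if n = 0 then u₀ else (μ * amp a n + μ ^ 2 * ampCorr δ a n) • e

/-- Compactness of the box, with μ = 0 included. After the leading power of μ is factored out, it
supplies every constant uniformly in μ and the parameters. -/
theorem exists_box_bound (M : ℝ) (f : ℝ × ℝ × ℝ × ℝ → ℝ) (hf : Continuous f) :
    ∃ C, 0 < C ∧ ∀ μ r s t : ℝ, 0 ≤ μ → μ ≤ 1 → |r| ≤ M → |s| ≤ M → |t| ≤ M →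
      |f (μ, r, s, t)| ≤ C := by
  have hc : IsCompact (Set.Icc (0 : ℝ) 1 ×ˢ Set.Icc (-M) M ×ˢ Set.Icc (-M) M ×ˢ Set.Icc (-M) M) :=
    isCompact_Icc.prod (isCompact_Icc.prod (isCompact_Icc.prod isCompact_Icc))
  obtain ⟨C, hC⟩ := hc.exists_bound_of_continuousOn hf.continuousOn
  refine ⟨|C| + 1, by positivity, fun μ r s t h0 h1 hr hs ht => ?_⟩
  have := hC (μ, r, s, t) ⟨⟨h0, h1⟩, abs_le.1 hr, abs_le.1 hs, abs_le.1 ht⟩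
  rw [Real.norm_eq_abs] at this
  linarith [le_abs_self C]

variable {X : Type*} [NormedCommRing X] [NormedAlgebra ℝ X]

theorem norm_le_of_eq_smul_of_le {x y : X} {s C B : ℝ} (hs : 0 ≤ s) (h : x = s • y)
    (hy : ‖y‖ ≤ C) (hsB : s ≤ B) (hC : 0 ≤ C) : ‖x‖ ≤ C * B := by
  rw [h, norm_smul, Real.norm_of_nonneg hs, mul_comm]
  exact mul_le_mul hy hsB hs hC

/-- The residual of the approximate solution. -/
theorem exists_residual_bound (e : X) (ℓ : X →L[ℝ] ℝ) (he : ℓ e = 1) (he3 : ℓ (e ^ 3) = 3 / 4)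
    {δ a c : ℝ} (hδ : δ ≠ 0) (hd : 8 * δ + 9 * a ^ 2 ≠ 0)
    (ha : 2 * δ * a + 3 / 4 * a ^ 3 + c = 0) (M : ℝ) :
    ∃ C, 0 < C ∧ ∀ μ r s t : ℝ, 0 < μ → μ ≤ 1 → |r| ≤ M → |s| ≤ M → |t| ≤ M →
      ∀ u₀ : X, ‖u₀‖ ≤ M → ℓ u₀ = c + μ ^ 2 * t → ∀ k : ℕ,
        ‖siteForce (μ ^ 2 * (2 * δ - 2 * μ + μ ^ 2 * r)) (μ ^ 2 * (μ + μ ^ 3 * s))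
          (approxSol δ a μ e u₀) (k + 1)‖ ≤ C * (μ ^ 3 * (1 / 2) ^ (k + 1)) ∧
        |ℓ (siteForce (μ ^ 2 * (2 * δ - 2 * μ + μ ^ 2 * r)) (μ ^ 2 * (μ + μ ^ 3 * s))
          (approxSol δ a μ e u₀) (k + 1))| ≤ C * (μ ^ 5 * (1 / 2) ^ (k + 1)) := by
  obtain ⟨b, hb⟩ : ∃ b, b = 8 * a / (8 * δ + 9 * a ^ 2) := ⟨_, rfl⟩
  obtain ⟨b', hb'⟩ : ∃ b', b' = -(a / (2 * δ)) := ⟨_, rfl⟩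
  -- Resonance at order μ⁴ at site 1; `hb2` is its analogue at site 2. Together with `ha` at order
  -- μ³ they remove everything below μ⁵ from the resonant component.
  have hb1 : 2 * δ * b + 9 / 4 * a ^ 2 * b - 2 * a = 0 := by
    have : b * (8 * δ + 9 * a ^ 2) = 8 * a := by rw [hb]; exact div_mul_cancel₀ _ hd
    linear_combination this / 4
  have hb2 : 2 * δ * b' + a = 0 := by rw [hb']; field_simp; ring
  obtain ⟨C₁, hC₁, h₁⟩ := exists_box_bound M (fun p =>
    |(2 * δ - 2 * p.1 + p.1 ^ 2 * p.2.1) * (a + p.1 * b)| * ‖e‖ + |(a + p.1 * b) ^ 3| * ‖e ^ 3‖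
      + |1 + p.1 ^ 2 * p.2.2.1| * (|p.1 ^ 2 * b'| * ‖e‖ + M)) (by fun_prop)
  obtain ⟨C₂, hC₂, h₂⟩ := exists_box_bound M (fun p =>
    -2 * b + p.2.1 * a + p.1 * p.2.1 * b + 9 / 4 * a * b ^ 2 + 3 / 4 * b ^ 3 * p.1 + b' + p.2.2.2
      + p.2.2.1 * c + p.1 ^ 2 * p.2.2.1 * (b' + p.2.2.2)) (by fun_prop)
  obtain ⟨C₃, hC₃, h₃⟩ := exists_box_bound M (fun p =>
    |(2 * δ - 2 * p.1 + p.1 ^ 2 * p.2.1) * b'| * ‖e‖ + |p.1 ^ 2 * b' ^ 3| * ‖e ^ 3‖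
      + |(1 + p.1 ^ 2 * p.2.2.1) * (a + p.1 * b)| * ‖e‖) (by fun_prop)
  obtain ⟨C₄, hC₄, h₄⟩ := exists_box_bound M (fun p =>
    (-2 + p.1 * p.2.1) * b' + 3 / 4 * p.1 * b' ^ 3 + b + p.1 * p.2.2.1 * (a + p.1 * b))
    (by fun_prop)
  obtain ⟨C₅, hC₅, h₅⟩ := exists_box_bound M (fun p =>
    |(1 + p.1 ^ 2 * p.2.2.1) * b'| * ‖e‖) (by fun_prop)
  obtain ⟨C₆, hC₆, h₆⟩ := exists_box_bound M (fun p =>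
    (1 + p.1 ^ 2 * p.2.2.1) * b') (by fun_prop)
  -- The residual vanishes from site 4 on, so 8 = 2³ absorbs the weights of the three remaining
  -- sites.
  refine ⟨8 * (C₁ + C₂ + C₃ + C₄ + C₅ + C₆), by positivity,
    fun μ r s t hμ hμ1 hr hs ht u₀ hu hℓ k => ?_⟩
  have h₁ := (le_abs_self _).trans (h₁ μ r s t hμ.le hμ1 hr hs ht)
  have h₂ := h₂ μ r s t hμ.le hμ1 hr hs ht
  have h₃ := (le_abs_self _).trans (h₃ μ r s t hμ.le hμ1 hr hs ht)
  have h₄ := h₄ μ r s t hμ.le hμ1 hr hs ht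
  have h₅ := (le_abs_self _).trans (h₅ μ r s t hμ.le hμ1 hr hs ht)
  have h₆ := h₆ μ r s t hμ.le hμ1 hr hs ht
  have hp3 : 0 < μ ^ 3 := by positivity
  have hp5 : 0 < μ ^ 5 := by positivity
  have hp43 : μ ^ 4 ≤ μ ^ 3 := pow_le_pow_of_le_one hμ.le hμ1 (by norm_num)
  have hp53 : μ ^ 5 ≤ μ ^ 3 := pow_le_pow_of_le_one hμ.le hμ1 (by norm_num)
  dsimp only at h₁ h₂ h₃ h₄ h₅ h₆
  obtain ⟨S, hS⟩ : ∃ S, S = C₁ + C₂ + C₃ + C₄ + C₅ + C₆ := ⟨_, rfl⟩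
  rw [← hS]
  have hS0 : 0 ≤ S := by rw [hS]; positivity
  have hfin : ∀ p C : ℝ, ∀ j : ℕ, 0 < p → C ≤ S → j ≤ 3 → C * p ≤ 8 * S * (p * (1 / 2) ^ j) :=
    fun p C j hp hCS hj => by
      have : (1 / 2 : ℝ) ^ 3 ≤ (1 / 2) ^ j :=
        pow_le_pow_of_le_one (by norm_num) (by norm_num) hj
      calc C * p ≤ S * p := by gcongr
        _ = 8 * S * (p * (1 / 2) ^ 3) := by ring
        _ ≤ _ := by
          gcongr
  have habs : ∀ x y C : ℝ, x = μ ^ 5 * y → |y| ≤ C → |x| ≤ C * μ ^ 5 := fun x y C h hy => by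
    rw [h, abs_mul, abs_of_pos hp5, mul_comm]; gcongr
  match k with
  | 0 =>
    have hN : siteForce (μ ^ 2 * (2 * δ - 2 * μ + μ ^ 2 * r)) (μ ^ 2 * (μ + μ ^ 3 * s))
        (approxSol δ a μ e u₀) (0 + 1) =
      μ ^ 3 • (((2 * δ - 2 * μ + μ ^ 2 * r) * (a + μ * b)) • e + ((a + μ * b) ^ 3) • e ^ 3
      + (1 + μ ^ 2 * s) • ((μ ^ 2 * b') • e + u₀)) := by
      simp only [siteForce, approxSol, amp, ampCorr, ← hb, ← hb']
      simp [Algebra.smul_def]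
      ring
    constructor
    · refine (norm_le_of_eq_smul_of_le hp3.le hN (C := C₁) ?_ le_rfl hC₁.le).trans ?_
      · refine (norm_add₃_le).trans (le_trans ?_ h₁)
        simp only [norm_smul, Real.norm_eq_abs]
        gcongr
        refine (norm_add_le _ _).trans ?_
        rw [norm_smul, Real.norm_eq_abs]
        gcongr
      · exact hfin _ _ _ hp3 (by linarith) (by norm_num)
    · refine (habs _ _ _ ?_ h₂).trans ?_
      · rw [hN]
        simp only [map_add, map_smul, smul_eq_mul, he, he3, hℓ]
        linear_combination μ ^ 3 * ha + μ ^ 4 * hb1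
      · exact hfin _ _ _ hp5 (by linarith) (by norm_num)
  | 1 =>
    have hN : siteForce (μ ^ 2 * (2 * δ - 2 * μ + μ ^ 2 * r)) (μ ^ 2 * (μ + μ ^ 3 * s))
        (approxSol δ a μ e u₀) (1 + 1) =
      μ ^ 4 • (((2 * δ - 2 * μ + μ ^ 2 * r) * b') • e + (μ ^ 2 * b' ^ 3) • e ^ 3
      + ((1 + μ ^ 2 * s) * (a + μ * b)) • e) := by
      simp only [siteForce, approxSol, amp, ampCorr, ← hb, ← hb']
      simp [Algebra.smul_def]
      ring
    constructor
    · refine (norm_le_of_eq_smul_of_le (by positivity) hN (C := C₃) ?_ hp43 hC₃.le).trans ?_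
      · refine (norm_add₃_le).trans (le_trans ?_ h₃)
        simp only [norm_smul, Real.norm_eq_abs]
        exact le_rfl
      · exact hfin _ _ _ hp3 (by linarith) (by norm_num)
    · refine (habs _ _ _ ?_ h₄).trans ?_
      · rw [hN]
        simp only [map_add, map_smul, smul_eq_mul, he, he3]
        linear_combination μ ^ 4 * hb2
      · exact hfin _ _ _ hp5 (by linarith) (by norm_num)
  | 2 =>
    have hN : siteForce (μ ^ 2 * (2 * δ - 2 * μ + μ ^ 2 * r)) (μ ^ 2 * (μ + μ ^ 3 * s))
        (approxSol δ a μ e u₀) (2 + 1) =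
      μ ^ 5 • (((1 + μ ^ 2 * s) * b') • e) := by
      simp only [siteForce, approxSol, amp, ampCorr, ← hb, ← hb']
      simp [Algebra.smul_def]
      ring
    constructor
    · refine (norm_le_of_eq_smul_of_le (by positivity) hN (C := C₅) ?_ hp53 hC₅.le).trans ?_
      · rwa [norm_smul, Real.norm_eq_abs]
      · exact hfin _ _ _ hp3 (by linarith) (by norm_num)
    · refine (habs _ _ _ ?_ h₆).trans ?_
      · rw [hN]
        simp only [map_smul, smul_eq_mul, he]
        ring
      · exact hfin _ _ _ hp5 (by linarith) (by norm_num)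
  | j + 3 =>
    have hN : siteForce (μ ^ 2 * (2 * δ - 2 * μ + μ ^ 2 * r)) (μ ^ 2 * (μ + μ ^ 3 * s))
        (approxSol δ a μ e u₀) (j + 3 + 1) = 0 := by
      simp [siteForce, approxSol, amp, ampCorr]
    rw [hN]
    constructor
    · rw [norm_zero]; positivity
    · rw [map_zero, abs_zero]; positivity

end

/-! ### Dependence of the force on the correction. -/

noncomputable section

variable {X : Type*} [NormedCommRing X] [NormedAlgebra ℝ X]

/-- The approximate solution with the correction `μ³ 2⁻ⁿ Vₙ`. -/
def corrected (δ a μ : ℝ) (e u₀ : X) (V : ℕ → X) (n : ℕ) : X :=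
  approxSol δ a μ e u₀ n + (μ ^ 3 * (1 / 2) ^ n) • V n

/-- Difference of the forces: its leading part is the linearization at the amplitude `a μ`. -/
theorem exists_force_sub (e : X) (δ a : ℝ) (M ρ : ℝ) (hM : 0 ≤ M) (hρ : 0 ≤ ρ) :
    ∃ C, 0 < C ∧ ∀ μ r s : ℝ, 0 < μ → μ ≤ 1 → |r| ≤ M → |s| ≤ M →
      ∀ u₀ : X, ∀ V V' : ℕ → X, ∀ D, (∀ m, ‖V m‖ ≤ ρ) → (∀ m, ‖V' m‖ ≤ ρ) →
      (∀ m, ‖V m - V' m‖ ≤ D) → ∀ k : ℕ, ∃ H : X,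
        siteForce (μ ^ 2 * (2 * δ - 2 * μ + μ ^ 2 * r)) (μ ^ 2 * (μ + μ ^ 3 * s))
          (corrected δ a μ e u₀ V) (k + 1) -
        siteForce (μ ^ 2 * (2 * δ - 2 * μ + μ ^ 2 * r)) (μ ^ 2 * (μ + μ ^ 3 * s))
          (corrected δ a μ e u₀ V') (k + 1) = (μ ^ 5 * (1 / 2) ^ (k + 1)) • H ∧
        ‖H - ((2 * δ) • (V (k + 1) - V' (k + 1)) +
          (3 * amp a (k + 1) ^ 2) • (e ^ 2 * (V (k + 1) - V' (k + 1))))‖ ≤ C * μ * D := by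
  obtain ⟨B, hB⟩ : ∃ B, B = |8 * a / (8 * δ + 9 * a ^ 2)| + |(a / (2 * δ))| := ⟨_, rfl⟩
  have hB0 : 0 ≤ B := by rw [hB]; positivity
  have hBk : ∀ n, |ampCorr δ a n| ≤ B := fun n => by
    unfold ampCorr
    split_ifs
    · rw [hB]; linarith [abs_nonneg (a / (2 * δ))]
    · rw [hB, abs_neg]; linarith [abs_nonneg (8 * a / (8 * δ + 9 * a ^ 2))]
    · simpa using hB0
  have hak : ∀ n, |amp a n| ≤ |a| := fun n => by
    unfold amp; split_ifs <;> simp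
  obtain ⟨Y, hY⟩ : ∃ Y, Y = B * ‖e‖ + ρ := ⟨_, rfl⟩
  have hY0 : 0 ≤ Y := by rw [hY]; positivity
  refine ⟨(2 + M) + (6 * |a| * ‖e‖ * Y + 3 * Y ^ 2) + 3 * (1 + M), by positivity,
    fun μ r s hμ hμ1 hr hs u₀ V V' D hV hV' hD k => ?_⟩
  have hD0 : 0 ≤ D := (norm_nonneg _).trans (hD 0)
  obtain ⟨w, hw⟩ : ∃ w : ℝ, w = (1 / 2) ^ (k + 1) := ⟨_, rfl⟩
  have hw0 : 0 ≤ w := by rw [hw]; positivity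
  have hw1 : w ≤ 1 := by rw [hw]; exact pow_le_one₀ (by norm_num) (by norm_num)
  have hwk : ((1 / 2) ^ k : ℝ) = 2 * w := by rw [hw]; ring
  have hwk2 : ((1 / 2) ^ (k + 2) : ℝ) = w / 2 := by rw [hw]; ring
  obtain ⟨α, hα⟩ : ∃ α, α = amp a (k + 1) := ⟨_, rfl⟩
  have hα' : |α| ≤ |a| := hα ▸ hak _
  -- Writing U = μ(αe + μy) isolates the leading part of the cubic: x² + xx' + x'² = μ²(3α²e² + μQ)
  -- with Q bounded.
  have hy : ∀ V : ℕ → X, (∀ m, ‖V m‖ ≤ ρ) → ∃ y : X, ‖y‖ ≤ Y ∧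
      corrected δ a μ e u₀ V (k + 1) = μ • (α • e + μ • y) ∧
      y = ampCorr δ a (k + 1) • e + (μ * w) • V (k + 1) := fun V hV => by
    refine ⟨_, ?_, ?_, rfl⟩
    · refine (norm_add_le _ _).trans ?_
      rw [norm_smul, norm_smul, Real.norm_eq_abs, Real.norm_of_nonneg (by positivity), hY]
      gcongr
      · exact hBk _
      · calc μ * w * ‖V (k + 1)‖ ≤ 1 * ρ :=
            mul_le_mul (mul_le_one₀ hμ1 hw0 hw1) (hV _) (norm_nonneg _) zero_le_one
          _ = ρ := one_mul _
    · rw [corrected, approxSol, if_neg (Nat.succ_ne_zero k), ← hw, ← hα]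
      module
  obtain ⟨y, hyY, hUy, hyV⟩ := hy V hV
  obtain ⟨y', hyY', hUy', hyV'⟩ := hy V' hV'
  obtain ⟨Δ, hΔ⟩ : ∃ Δ, Δ = V (k + 1) - V' (k + 1) := ⟨_, rfl⟩
  have hΔD : ‖Δ‖ ≤ D := hΔ ▸ hD _
  have hyy : y - y' = (μ * w) • Δ := by rw [hyV, hyV', hΔ]; module
  have hnext : corrected δ a μ e u₀ V (k + 2) - corrected δ a μ e u₀ V' (k + 2) =
      (μ ^ 3 * w) • ((1 / 2 : ℝ) • (V (k + 2) - V' (k + 2))) := by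
    rw [corrected, corrected, hwk2]; module
  -- The weight of the preceding site is only twice larger, so the neighbours contribute a bounded
  -- factor, and γ ~ μ³ makes them smaller by μ than the linear part.
  have hprev : corrected δ a μ e u₀ V k - corrected δ a μ e u₀ V' k =
      (μ ^ 3 * w) • ((2 : ℝ) • (V k - V' k)) := by
    rw [corrected, corrected, hwk]; module
  obtain ⟨P, hP⟩ : ∃ P, P = (1 / 2 : ℝ) • (V (k + 2) - V' (k + 2)) + (2 : ℝ) • (V k - V' k) :=
    ⟨_, rfl⟩
  have hPD : ‖P‖ ≤ 3 * D := by
    rw [hP]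
    refine (norm_add_le _ _).trans ?_
    rw [norm_smul, norm_smul]
    norm_num
    linarith [hD (k + 2), hD k]
  obtain ⟨Q, hQ⟩ : ∃ Q : X, Q = (3 * α) • (e * (y + y')) + μ • (y ^ 2 + y * y' + y' ^ 2) :=
    ⟨_, rfl⟩
  have hQn : ‖Q‖ ≤ 6 * |a| * ‖e‖ * Y + 3 * Y ^ 2 := by
    have h1 : ‖y + y'‖ ≤ 2 * Y := (norm_add_le _ _).trans (by linarith)
    have h2 : ‖e * (y + y')‖ ≤ ‖e‖ * (2 * Y) := (norm_mul_le _ _).trans (by gcongr)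
    have h3 : ∀ x x' : X, ‖x‖ ≤ Y → ‖x'‖ ≤ Y → ‖x * x'‖ ≤ Y * Y := fun x x' hx hx' =>
      (norm_mul_le _ _).trans (mul_le_mul hx hx' (norm_nonneg _) hY0)
    have h4 : ‖y ^ 2 + y * y' + y' ^ 2‖ ≤ 3 * Y ^ 2 := by
      rw [pow_two, pow_two y']
      refine norm_add₃_le.trans ?_
      linarith [h3 _ _ hyY hyY, h3 _ _ hyY hyY', h3 _ _ hyY' hyY', pow_two Y]
    rw [hQ]
    refine (norm_add_le _ _).trans ?_
    rw [norm_smul, norm_smul, Real.norm_eq_abs, Real.norm_of_nonneg hμ.le, abs_mul, abs_of_pos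
      (by norm_num : (0 : ℝ) < 3)]
    calc 3 * |α| * ‖e * (y + y')‖ + μ * ‖y ^ 2 + y * y' + y' ^ 2‖
        ≤ 3 * |a| * (‖e‖ * (2 * Y)) + 1 * (3 * Y ^ 2) := by gcongr
      _ = _ := by ring
  refine ⟨((2 * δ) • Δ + (3 * α ^ 2) • (e ^ 2 * Δ)) +
    μ • (((-2 + μ * r) • Δ) + Q * Δ + (1 + μ ^ 2 * s) • P), ?_, ?_⟩
  · rw [siteForce, siteForce, ← hw]
    have hc : ∀ x x' : X, x ^ 3 - x' ^ 3 = (x ^ 2 + x * x' + x' ^ 2) * (x - x') := fun x x' => by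
      ring
    have hsub : corrected δ a μ e u₀ V (k + 1) - corrected δ a μ e u₀ V' (k + 1) =
        (μ ^ 3 * w) • Δ := by
      rw [hUy, hUy']
      calc _ = (μ ^ 2) • (y - y') := by module
        _ = _ := by rw [hyy]; module
    have hsq : corrected δ a μ e u₀ V (k + 1) ^ 2 +
        corrected δ a μ e u₀ V (k + 1) * corrected δ a μ e u₀ V' (k + 1) +
        corrected δ a μ e u₀ V' (k + 1) ^ 2 = (μ ^ 2) • ((3 * α ^ 2) • e ^ 2 + μ • Q) := by
      rw [hUy, hUy', hQ]
      simp only [Algebra.smul_def, map_mul, map_pow, map_ofNat]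
      ring
    rw [show k + 1 + 1 = k + 2 from rfl, show k + 1 - 1 = k from rfl]
    generalize corrected δ a μ e u₀ V (k + 1) = x at *
    generalize corrected δ a μ e u₀ V' (k + 1) = x' at *
    calc _ = (μ ^ 2 * (2 * δ - 2 * μ + μ ^ 2 * r)) • (x - x') + (x ^ 3 - x' ^ 3) +
          (μ ^ 2 * (μ + μ ^ 3 * s)) •
            ((corrected δ a μ e u₀ V (k + 2) - corrected δ a μ e u₀ V' (k + 2)) +
            (corrected δ a μ e u₀ V k - corrected δ a μ e u₀ V' k)) := by module
      _ = _ := by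
        rw [hc, hsq, hsub, hnext, hprev, ← smul_add (μ ^ 3 * w), ← hP]
        simp only [Algebra.smul_def, map_mul, map_pow, map_add, map_sub, map_neg, map_one]
        ring
  · rw [← hα, ← hΔ, add_sub_cancel_left, norm_smul, Real.norm_of_nonneg hμ.le]
    have h1 : |(-2 + μ * r)| ≤ 2 + M := by
      refine (abs_add_le _ _).trans ?_
      rw [abs_mul, abs_of_pos hμ, abs_neg, abs_two]
      nlinarith [abs_nonneg r]
    have h2 : |1 + μ ^ 2 * s| ≤ 1 + M := by
      refine (abs_add_le _ _).trans ?_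
      rw [abs_mul, abs_of_nonneg (by positivity : 0 ≤ μ ^ 2), abs_one]
      nlinarith [abs_nonneg s, pow_le_one₀ hμ.le hμ1 (n := 2)]
    have h3 : ‖((-2 + μ * r) • Δ) + Q * Δ + (1 + μ ^ 2 * s) • P‖ ≤
        (2 + M) * D + (6 * |a| * ‖e‖ * Y + 3 * Y ^ 2) * D + (1 + M) * (3 * D) := by
      refine norm_add₃_le.trans ?_
      rw [norm_smul, norm_smul, Real.norm_eq_abs, Real.norm_eq_abs]
      gcongr
      exact (norm_mul_le _ _).trans (by gcongr)
    calc _ ≤ μ * _ := mul_le_mul_of_nonneg_left h3 hμ.le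
      _ = _ := by ring

end

/-! ### Lyapunov–Schmidt reduction on the half-lattice. -/

noncomputable section

variable {X : Type*} [NormedCommRing X] [NormedAlgebra ℝ X]

/-- The map whose fixed points are corrections that turn the approximate solution into a
solution: a Lyapunov–Schmidt reduction with a Newton step for the resonant component. -/
def stepMap (e : X) (ℓ : X →L[ℝ] ℝ) (K : X →L[ℝ] X) (δ a μ β γ : ℝ) (u₀ : X) (V : ℕ → X) :
    ℕ → X
  | 0 => 0
  | k + 1 =>
    (ℓ (V (k + 1)) - (2 * δ + 9 / 4 * amp a (k + 1) ^ 2)⁻¹ * ((μ ^ 5 * (1 / 2) ^ (k + 1))⁻¹ *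
        ℓ (siteForce β γ (corrected δ a μ e u₀ V) (k + 1)))
      -- The scaled resonant force also depends at order one on the non-resonant part of V, through
      -- 3α²ℓ(e²·). This term trades the old non-resonant part for the updated one, and it vanishes
      -- at a fixed point.
      + (2 * δ + 9 / 4 * amp a (k + 1) ^ 2)⁻¹ * (3 * amp a (k + 1) ^ 2 *
        ℓ (e ^ 2 * (V (k + 1) - ℓ (V (k + 1)) • e - (μ ^ 3 * (1 / 2) ^ (k + 1))⁻¹ •
          K (siteForce β γ (corrected δ a μ e u₀ V) (k + 1)))))) • e
    + (μ ^ 3 * (1 / 2) ^ (k + 1))⁻¹ • K (siteForce β γ (corrected δ a μ e u₀ V) (k + 1))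

-- The Newton step cancels the leading linear part exactly, and the non-resonant update is
-- O(μ²)-Lipschitz, so `stepMap` has Lipschitz constant O(μ) on a fixed ball. Applying ℓ to the
-- fixed-point equation, with ℓ ∘ K = 0, splits it into the solvability condition and the range
-- equation.
set_option maxHeartbeats 1000000 in
theorem exists_halfLattice_solution [CompleteSpace X] (e : X) (ℓ : X →L[ℝ] ℝ) (K : X →L[ℝ] X)
    (he : ℓ e = 1) (he3 : ℓ (e ^ 3) = 3 / 4) (hK : ∀ g, ℓ (K g) = 0)
    {δ a c : ℝ} (hδ : δ ≠ 0) (hd : 8 * δ + 9 * a ^ 2 ≠ 0)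
    (ha : 2 * δ * a + 3 / 4 * a ^ 3 + c = 0) (M : ℝ) (hM : 0 ≤ M) :
    ∃ μ₀ C, 0 < μ₀ ∧ 0 < C ∧ ∀ μ r s t : ℝ, 0 < μ → μ < μ₀ → |r| ≤ M → |s| ≤ M → |t| ≤ M →
      ∀ u₀ : X, ‖u₀‖ ≤ M → ℓ u₀ = c + μ ^ 2 * t → ∃ U : ℕ → X, U 0 = u₀ ∧ ∀ n, n ≠ 0 →
        ‖U n - approxSol δ a μ e u₀ n‖ ≤ C * (μ ^ 3 * (1 / 2) ^ n) ∧
        ‖siteForce (μ ^ 2 * (2 * δ - 2 * μ + μ ^ 2 * r)) (μ ^ 2 * (μ + μ ^ 3 * s)) U n‖ ≤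
          C * (μ ^ 3 * (1 / 2) ^ n) ∧
        ℓ (siteForce (μ ^ 2 * (2 * δ - 2 * μ + μ ^ 2 * r)) (μ ^ 2 * (μ + μ ^ 3 * s)) U n) = 0 ∧
        U n = ℓ (U n) • e +
          K (siteForce (μ ^ 2 * (2 * δ - 2 * μ + μ ^ 2 * r)) (μ ^ 2 * (μ + μ ^ 3 * s)) U n) := by
  obtain ⟨C, hC, hres⟩ := exists_residual_bound e ℓ he he3 hδ hd ha M
  obtain ⟨E, hE⟩ : ∃ E, E = |(2 * δ + 9 / 4 * a ^ 2)⁻¹| + |(2 * δ)⁻¹| := ⟨_, rfl⟩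
  have hE0 : 0 ≤ E := by rw [hE]; positivity
  have hEk : ∀ n, |(2 * δ + 9 / 4 * amp a n ^ 2)⁻¹| ≤ E := fun n => by
    unfold amp
    split_ifs
    · rw [hE]; linarith [abs_nonneg (2 * δ)⁻¹]
    · rw [hE]; simp
  have hdn : ∀ n, 2 * δ + 9 / 4 * amp a n ^ 2 ≠ 0 := fun n => by
    unfold amp
    split_ifs
    · contrapose! hd; linarith
    · simpa using hδ
  have hak : ∀ n, 3 * amp a n ^ 2 ≤ 3 * a ^ 2 := fun n => by
    unfold amp; split_ifs <;> simp; positivity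
  have hak0 : ∀ n, 0 ≤ 3 * amp a n ^ 2 := fun n => by positivity
  -- Twice the bound for `stepMap` at the zero sequence, as `exists_fixed_seq` requires.
  obtain ⟨ρ, hρ⟩ : ∃ ρ, ρ = 2 * ((E * C + E * (3 * a ^ 2 * (‖ℓ‖ * (‖e ^ 2‖ * (‖K‖ * C))))) * ‖e‖
    + ‖K‖ * C) := ⟨_, rfl⟩
  have hρ0 : 0 ≤ ρ := by rw [hρ]; positivity
  obtain ⟨C', hC', hlip⟩ := exists_force_sub e δ a M ρ hM hρ0
  obtain ⟨h, hh⟩ : ∃ h, h = C' + 2 * |δ| + 3 * a ^ 2 * ‖e ^ 2‖ := ⟨_, rfl⟩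
  have hh0 : 0 ≤ h := by rw [hh]; positivity
  -- The Lipschitz constant will be Λμ; the choice of μ₀ below makes it at most 1/2.
  obtain ⟨Λ, hΛ⟩ : ∃ Λ, Λ = E * (‖ℓ‖ * C' + 3 * a ^ 2 * (‖ℓ‖ * (‖e ^ 2‖ * (‖K‖ * h)))) * ‖e‖
    + ‖K‖ * h := ⟨_, rfl⟩
  have hΛ0 : 0 ≤ Λ := by rw [hΛ]; positivity
  have hHle : ∀ μ D : ℝ, 0 ≤ D → μ ≤ 1 → ∀ (n : ℕ) (H Δ : X), ‖Δ‖ ≤ D →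
      ‖H - ((2 * δ) • Δ + (3 * amp a n ^ 2) • (e ^ 2 * Δ))‖ ≤ C' * μ * D → ‖H‖ ≤ h * D := by
    intro μ D hD hμ n H Δ hΔ hH
    have h1 : ‖(2 * δ) • Δ + (3 * amp a n ^ 2) • (e ^ 2 * Δ)‖ ≤
        2 * |δ| * D + 3 * a ^ 2 * (‖e ^ 2‖ * D) := by
      refine (norm_add_le _ _).trans ?_
      rw [norm_smul, norm_smul, Real.norm_eq_abs, abs_mul, abs_two, Real.norm_of_nonneg (hak0 n)]
      have := hak n
      gcongr
      exact (norm_mul_le _ _).trans (by gcongr)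
    have h2 : C' * μ * D ≤ C' * 1 * D := by gcongr
    have h3 := norm_le_norm_add_norm_sub
      ((2 * δ) • Δ + (3 * amp a n ^ 2) • (e ^ 2 * Δ)) H
    rw [norm_sub_rev] at h3
    rw [hh]
    linarith
  refine ⟨min 1 (1 / (2 * Λ + 1)), C + h * ρ + ρ, by positivity, by positivity,
    fun μ r s t hμ hμ' hr hs ht u₀ hu hℓ => ?_⟩
  have hμ1 : μ ≤ 1 := (hμ'.trans_le (min_le_left _ _)).le
  have hμΛ : Λ * μ ≤ 1 / 2 := by
    have := hμ'.trans_le (min_le_right _ _)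
    rw [lt_div_iff₀ (by positivity)] at this
    linarith
  specialize hres μ r s t hμ hμ1 hr hs ht u₀ hu hℓ
  specialize hlip μ r s hμ hμ1 hr hs u₀
  generalize μ ^ 2 * (2 * δ - 2 * μ + μ ^ 2 * r) = β at *
  generalize μ ^ 2 * (μ + μ ^ 3 * s) = γ at *
  have hcor0 : corrected δ a μ e u₀ 0 = approxSol δ a μ e u₀ := by
    funext n; simp [corrected]
  obtain ⟨V, hVρ, hV⟩ := exists_fixed_seq (stepMap e ℓ K δ a μ β γ u₀) hρ0 (by
    intro V V' D hV hV' hD n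
    have hD0 : 0 ≤ D := (norm_nonneg _).trans (hD 0)
    match n with
    | 0 => simp only [stepMap, sub_self, norm_zero]; positivity
    | k + 1 =>
      obtain ⟨H, hH, hHb⟩ := hlip V V' D hV hV' hD k
      have hHn := hHle μ D hD0 hμ1 (k + 1) H _ (hD (k + 1)) hHb
      simp only [stepMap]
      have hw0 : (0 : ℝ) < (1 / 2) ^ (k + 1) := by positivity
      have hEk := hEk (k + 1)
      have hdn := hdn (k + 1)
      have hak := hak (k + 1)
      have hak0 := hak0 (k + 1)
      have hΔD := hD (k + 1)
      generalize ((1 / 2) ^ (k + 1) : ℝ) = w at *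
      generalize V (k + 1) = v at *
      generalize V' (k + 1) = v' at *
      generalize siteForce β γ (corrected δ a μ e u₀ V) (k + 1) = N at *
      generalize siteForce β γ (corrected δ a μ e u₀ V') (k + 1) = N' at *
      generalize amp a (k + 1) = α at *
      have hN : N = N' + (μ ^ 5 * w) • H := by rw [← hH]; abel
      have hμne : μ ≠ 0 := hμ.ne'
      have hwne : w ≠ 0 := hw0.ne'
      have hKN : (μ ^ 3 * w)⁻¹ • K N = (μ ^ 3 * w)⁻¹ • K N' + μ ^ 2 • K H := by
        rw [hN, map_add, map_smul, smul_add, smul_smul]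
        congr 2
        field_simp
      have hℓN : (μ ^ 5 * w)⁻¹ * ℓ N = (μ ^ 5 * w)⁻¹ * ℓ N' + ℓ H := by
        rw [hN, map_add, map_smul, smul_eq_mul]
        field_simp
      rw [hKN, hℓN]
      generalize (μ ^ 3 * w)⁻¹ • K N' = W
      generalize (μ ^ 5 * w)⁻¹ * ℓ N' = S
      obtain ⟨A, hA⟩ : ∃ A, A = (2 * δ + 9 / 4 * α ^ 2)⁻¹ := ⟨_, rfl⟩
      have hAd : A * (2 * δ + 9 / 4 * α ^ 2) = 1 := by rw [hA]; exact inv_mul_cancel₀ hdn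
      rw [← hA] at hEk ⊢
      obtain ⟨Rm, hRm⟩ : ∃ Rm, Rm = H - ((2 * δ) • (v - v') + (3 * α ^ 2) • (e ^ 2 * (v - v'))) :=
        ⟨_, rfl⟩
      rw [← hRm] at hHb
      -- Since ℓ(e³) = 3/4, the coefficient of ℓ(v − v') is 1 − A(2δ + 9α²/4) = 0, and the terms
      -- ℓ(e²v), ℓ(e²v') cancel. Only the remainder `Rm` and the O(μ²) change of the non-resonant
      -- part survive.
      have key : (ℓ v - A * (S + ℓ H) + A * (3 * α ^ 2 * ℓ (e ^ 2 * (v - ℓ v • e - (W + μ ^ 2 • K H)))))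
          - (ℓ v' - A * S + A * (3 * α ^ 2 * ℓ (e ^ 2 * (v' - ℓ v' • e - W)))) =
          -(A * (ℓ Rm + 3 * α ^ 2 * (μ ^ 2 * ℓ (e ^ 2 * K H)))) := by
        have e1 : ℓ (e ^ 2 * (v - ℓ v • e - (W + μ ^ 2 • K H))) = ℓ (e ^ 2 * v) - ℓ v * (3 / 4)
            - ℓ (e ^ 2 * W) - μ ^ 2 * ℓ (e ^ 2 * K H) := by
          rw [mul_sub, mul_sub, mul_add, mul_smul_comm, mul_smul_comm, ← pow_succ]
          simp only [map_sub, map_add, map_smul, smul_eq_mul, he3]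
          ring
        have e2 : ℓ (e ^ 2 * (v' - ℓ v' • e - W)) = ℓ (e ^ 2 * v') - ℓ v' * (3 / 4)
            - ℓ (e ^ 2 * W) := by
          rw [mul_sub, mul_sub, mul_smul_comm, ← pow_succ]
          simp only [map_sub, map_smul, smul_eq_mul, he3]
        have e3 : ℓ Rm = ℓ H - 2 * δ * (ℓ v - ℓ v') -
            3 * α ^ 2 * (ℓ (e ^ 2 * v) - ℓ (e ^ 2 * v')) := by
          rw [hRm]
          simp only [map_sub, map_add, map_smul, smul_eq_mul, mul_sub]
          ring
        rw [e1, e2, e3]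
        linear_combination -(ℓ v - ℓ v') * hAd
      have hz : ‖-(A * (ℓ Rm + 3 * α ^ 2 * (μ ^ 2 * ℓ (e ^ 2 * K H))))‖ ≤
          E * (‖ℓ‖ * (C' * μ * D) + 3 * a ^ 2 * (μ * (‖ℓ‖ * (‖e ^ 2‖ * (‖K‖ * (h * D)))))) := by
        rw [norm_neg, norm_mul A]
        have i1 : ‖ℓ Rm‖ ≤ ‖ℓ‖ * (C' * μ * D) := ℓ.le_opNorm_of_le hHb
        have i2 : ‖ℓ (e ^ 2 * K H)‖ ≤ ‖ℓ‖ * (‖e ^ 2‖ * (‖K‖ * (h * D))) :=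
          ℓ.le_opNorm_of_le ((norm_mul_le _ _).trans
            (mul_le_mul_of_nonneg_left (K.le_opNorm_of_le hHn) (norm_nonneg _)))
        have i3 : μ ^ 2 ≤ μ := by nlinarith
        refine mul_le_mul hEk ?_ (norm_nonneg _) hE0
        refine (norm_add_le _ _).trans (add_le_add i1 ?_)
        rw [norm_mul (3 * α ^ 2), norm_mul (μ ^ 2), Real.norm_of_nonneg hak0,
          Real.norm_of_nonneg (by positivity)]
        gcongr
      have hw : ‖μ ^ 2 • K H‖ ≤ μ * (‖K‖ * (h * D)) := by
        rw [norm_smul, Real.norm_of_nonneg (by positivity)]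
        have i3 : μ ^ 2 ≤ μ := by nlinarith
        exact mul_le_mul i3 (K.le_opNorm_of_le hHn) (norm_nonneg _) hμ.le
      calc _ = ‖(-(A * (ℓ Rm + 3 * α ^ 2 * (μ ^ 2 * ℓ (e ^ 2 * K H))))) • e + μ ^ 2 • K H‖ := by
            rw [← key]; congr 1; module
        _ ≤ _ := norm_add_le _ _
        _ ≤ E * (‖ℓ‖ * (C' * μ * D) + 3 * a ^ 2 * (μ * (‖ℓ‖ * (‖e ^ 2‖ * (‖K‖ * (h * D)))))) * ‖e‖
            + μ * (‖K‖ * (h * D)) := by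
          rw [norm_smul]
          gcongr
        _ = Λ * μ * D := by rw [hΛ]; ring
        _ ≤ 1 / 2 * D := by gcongr
        _ = D / 2 := by ring) (by
    intro n
    match n with
    | 0 => simp only [stepMap, norm_zero]; positivity
    | k + 1 =>
      obtain ⟨h1, h2⟩ := hres k
      simp only [stepMap, hcor0, Pi.zero_apply, map_zero, zero_smul, zero_sub, sub_zero]
      have hw0 : (0 : ℝ) < (1 / 2) ^ (k + 1) := by positivity
      have hEk := hEk (k + 1)
      have hak := hak (k + 1)
      have hak0 := hak0 (k + 1)
      generalize ((1 / 2) ^ (k + 1) : ℝ) = w at *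
      generalize siteForce β γ (approxSol δ a μ e u₀) (k + 1) = N at *
      generalize amp a (k + 1) = α at *
      generalize (2 * δ + 9 / 4 * α ^ 2)⁻¹ = A at *
      have hW : ‖(μ ^ 3 * w)⁻¹ • K N‖ ≤ ‖K‖ * C := by
        rw [norm_smul, Real.norm_of_nonneg (by positivity), inv_mul_le_iff₀ (by positivity)]
        refine (K.le_opNorm_of_le h1).trans (le_of_eq ?_)
        ring
      have hS : |(μ ^ 5 * w)⁻¹ * ℓ N| ≤ C := by
        rw [abs_mul, abs_of_pos (by positivity), inv_mul_le_iff₀ (by positivity), mul_comm _ C]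
        exact h2
      generalize (μ ^ 3 * w)⁻¹ • K N = W at *
      generalize (μ ^ 5 * w)⁻¹ * ℓ N = S at *
      have i1 : ‖ℓ (e ^ 2 * -W)‖ ≤ ‖ℓ‖ * (‖e ^ 2‖ * (‖K‖ * C)) :=
        ℓ.le_opNorm_of_le ((norm_mul_le _ _).trans
          (mul_le_mul_of_nonneg_left ((norm_neg W).trans_le hW) (norm_nonneg _)))
      refine (norm_add_le _ _).trans ?_
      rw [norm_smul]
      have i2 : ‖-(A * S) + A * (3 * α ^ 2 * ℓ (e ^ 2 * -W))‖ ≤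
          E * C + E * (3 * a ^ 2 * (‖ℓ‖ * (‖e ^ 2‖ * (‖K‖ * C)))) := by
        refine (norm_add_le _ _).trans ?_
        rw [norm_neg, norm_mul A, norm_mul A, norm_mul (3 * α ^ 2), Real.norm_of_nonneg hak0]
        refine add_le_add (mul_le_mul hEk hS (norm_nonneg _) hE0) ?_
        refine mul_le_mul hEk ?_ (by positivity) hE0
        gcongr
      rw [hρ]
      have := mul_le_mul_of_nonneg_right i2 (norm_nonneg e)
      linarith)
  refine ⟨corrected δ a μ e u₀ V, ?_, fun n hn => ?_⟩
  -- `stepMap` is zero at index 0, so the prescribed central component is untouched.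
  · have : V 0 = 0 := by rw [← hV]; rfl
    simp [corrected, approxSol, this]
  obtain ⟨k, rfl⟩ := Nat.exists_eq_succ_of_ne_zero hn
  rw [Nat.succ_eq_add_one]
  have hp : 0 < μ ^ 3 * (1 / 2) ^ (k + 1) := by positivity
  have hVk := congrFun hV (k + 1)
  simp only [stepMap] at hVk
  have hsplit : ℓ (V (k + 1)) • e + (μ ^ 3 * (1 / 2) ^ (k + 1))⁻¹ •
      K (siteForce β γ (corrected δ a μ e u₀ V) (k + 1)) = V (k + 1) := by
    have h1 := congrArg ℓ hVk
    simp only [map_add, map_smul, smul_eq_mul, he, hK, mul_zero, add_zero, mul_one] at h1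
    rw [h1] at hVk
    exact hVk
  refine ⟨?_, ?_, ?_, ?_⟩
  · rw [corrected, add_sub_cancel_left, norm_smul, Real.norm_of_nonneg hp.le, mul_comm]
    gcongr
    have : 0 ≤ C + h * ρ := by positivity
    linarith [hVρ (k + 1)]
  -- Comparison with V' = 0, whose force is the residual of the approximate solution.
  · obtain ⟨H, hH, hHb⟩ := hlip V 0 ρ hVρ (by simpa using hρ0) (by simpa using hVρ) k
    have hHn := hHle μ ρ hρ0 hμ1 (k + 1) H _ (by simpa using hVρ (k + 1)) hHb
    rw [hcor0] at hH
    have h1 := norm_le_norm_add_norm_sub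
      (siteForce β γ (approxSol δ a μ e u₀) (k + 1))
      (siteForce β γ (corrected δ a μ e u₀ V) (k + 1))
    rw [norm_sub_rev, hH, norm_smul, Real.norm_of_nonneg (by positivity)] at h1
    have h2 : μ ^ 5 * (1 / 2) ^ (k + 1) * ‖H‖ ≤ μ ^ 3 * (1 / 2) ^ (k + 1) * (h * ρ) := by
      have : μ ^ 5 ≤ μ ^ 3 := pow_le_pow_of_le_one hμ.le hμ1 (by norm_num)
      gcongr
    have h3 := (hres k).1
    have h4 : 0 ≤ ρ * (μ ^ 3 * (1 / 2) ^ (k + 1)) := by positivity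
    linarith
  · have h1 := congrArg ℓ hVk
    have hw : V (k + 1) - ℓ (V (k + 1)) • e - (μ ^ 3 * (1 / 2) ^ (k + 1))⁻¹ •
        K (siteForce β γ (corrected δ a μ e u₀ V) (k + 1)) = 0 := by
      nth_rewrite 1 [← hsplit]; abel
    rw [hw] at h1
    simp only [map_add, map_smul, smul_eq_mul, he, hK, mul_zero, add_zero, mul_one, map_zero] at h1
    have h2 : (2 * δ + 9 / 4 * amp a (k + 1) ^ 2)⁻¹ * ((μ ^ 5 * (1 / 2) ^ (k + 1))⁻¹ *
        ℓ (siteForce β γ (corrected δ a μ e u₀ V) (k + 1))) = 0 := by linarith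
    have h3 := (mul_eq_zero.1 h2).resolve_left (inv_ne_zero (hdn _))
    exact (mul_eq_zero.1 h3).resolve_left (by positivity)
  · nth_rewrite 1 [corrected]
    nth_rewrite 1 [← hsplit]
    rw [smul_add, smul_inv_smul₀ hp.ne', ← add_assoc]
    congr 1
    rw [corrected, approxSol, if_neg (Nat.succ_ne_zero k)]
    simp only [map_add, map_smul, smul_eq_mul, he]
    module

end

/-! ### The algebra of even periodic functions and the resonant oscillator. -/

noncomputable section

open scoped BoundedContinuousFunction

/-- The even `6π`-periodic continuous functions. -/
def evenPer : Subalgebra ℝ (ℝ →ᵇ ℝ) where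
  carrier := {f | (∀ τ, f (-τ) = f τ) ∧ ∀ τ, f (τ + 6 * π) = f τ}
  mul_mem' := fun hf hg => ⟨fun τ => by simp [hf.1 τ, hg.1 τ], fun τ => by simp [hf.2 τ, hg.2 τ]⟩
  add_mem' := fun hf hg => ⟨fun τ => by simp [hf.1 τ, hg.1 τ], fun τ => by simp [hf.2 τ, hg.2 τ]⟩
  algebraMap_mem' := fun r => ⟨fun τ => rfl, fun τ => rfl⟩

theorem isClosed_evenPer : IsClosed (evenPer : Set (ℝ →ᵇ ℝ)) := by
  have h : (evenPer : Set (ℝ →ᵇ ℝ)) =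
      {f | (∀ τ, f (-τ) = f τ) ∧ ∀ τ, f (τ + 6 * π) = f τ} := rfl
  rw [h, Set.ofPred_and, Set.ofPred_forall, Set.ofPred_forall]
  refine (isClosed_iInter fun τ => ?_).inter (isClosed_iInter fun τ => ?_) <;>
  exact isClosed_eq (BoundedContinuousFunction.lipschitz_eval_const _).continuous
    (BoundedContinuousFunction.lipschitz_eval_const _).continuous

/-- The Banach algebra of even `6π`-periodic continuous functions with the uniform norm. -/
def EvenPer : Type := evenPer

instance : NormedCommRing EvenPer := inferInstanceAs (NormedCommRing evenPer)

instance : NormedAlgebra ℝ EvenPer := inferInstanceAs (NormedAlgebra ℝ evenPer)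

instance : CompleteSpace EvenPer := isClosed_evenPer.completeSpace_coe

namespace EvenPer

theorem even (f : EvenPer) (τ : ℝ) : f.1 (-τ) = f.1 τ := f.2.1 τ

theorem periodic (f : EvenPer) : Function.Periodic f.1 (6 * π) := f.2.2

theorem abs_apply_le (f : EvenPer) (τ : ℝ) : |f.1 τ| ≤ ‖f‖ := f.1.norm_coe_le_norm τ

theorem norm_le {f : EvenPer} {C : ℝ} (hC : 0 ≤ C) (h : ∀ τ, |f.1 τ| ≤ C) : ‖f‖ ≤ C :=
  (BoundedContinuousFunction.norm_le hC).2 h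

/-- A continuous even periodic function as an element of `EvenPer`. -/
def mk (f : ℝ → ℝ) (hc : Continuous f) (he : ∀ τ, f (-τ) = f τ)
    (hp : Function.Periodic f (6 * π)) : EvenPer :=
  ⟨BoundedContinuousFunction.mkOfBound ⟨f, hc⟩
    (hp.isBounded_of_continuous (by positivity) hc |> fun h => (Metric.isBounded_iff.1 h).choose)
    (fun x y => by
      exact (Metric.isBounded_iff.1 (hp.isBounded_of_continuous (by positivity) hc)).choose_spec
        ⟨x, rfl⟩ ⟨y, rfl⟩), he, hp⟩

theorem cos_add_period : Function.Periodic cos (6 * π) := fun τ => by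
  rw [show τ + 6 * π = τ + (3 : ℕ) * (2 * π) by push_cast; ring, cos_add_nat_mul_two_pi]

theorem sin_add_period : Function.Periodic sin (6 * π) := fun τ => by
  rw [show τ + 6 * π = τ + (3 : ℕ) * (2 * π) by push_cast; ring, sin_add_nat_mul_two_pi]

/-- The resonant mode `cos`. -/
def cosMode : EvenPer := mk cos continuous_cos cos_neg cos_add_period

theorem cosMode_apply (τ : ℝ) : cosMode.1 τ = cos τ := rfl

theorem abs_integral_le {f : ℝ → ℝ} {C t : ℝ} (h : ∀ s, |f s| ≤ C) (ht : 0 ≤ t)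
    (ht' : t ≤ 6 * π) : |∫ s in (0 : ℝ)..t, f s| ≤ C * (6 * π) := by
  have h1 := intervalIntegral.norm_integral_le_of_norm_le_const (a := 0) (b := t)
    (fun s _ => (Real.norm_eq_abs (f s)).trans_le (h s))
  have hC : 0 ≤ C := (abs_nonneg _).trans (h 0)
  rw [Real.norm_eq_abs, sub_zero, abs_of_nonneg ht] at h1
  exact h1.trans (by gcongr)

/-- The Fourier coefficient of `cos`. -/
def coeff : EvenPer →L[ℝ] ℝ :=
  LinearMap.mkContinuous
    { toFun := fun f : EvenPer => (1 / (3 * π)) * ∫ τ in (0 : ℝ)..(6 * π), f.1 τ * cos τ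
      map_add' := fun f g => by
        rw [← mul_add, ← intervalIntegral.integral_add
          (Continuous.intervalIntegrable (by fun_prop) _ _)
          (Continuous.intervalIntegrable (by fun_prop) _ _)]
        congr 2
        funext τ
        rw [← add_mul]; rfl
      map_smul' := fun c f => by
        rw [RingHom.id_apply, smul_eq_mul, mul_left_comm]
        congr 1
        rw [← intervalIntegral.integral_const_mul]
        congr 1
        funext τ
        rw [← mul_assoc]; rfl } 2 fun f : EvenPer => by
    have h1 : |∫ τ in (0 : ℝ)..(6 * π), f.1 τ * cos τ| ≤ ‖f‖ * (6 * π) := by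
      refine abs_integral_le (fun s => ?_) (by positivity) le_rfl
      rw [abs_mul]
      exact (mul_le_mul (f.abs_apply_le s) (abs_cos_le_one s) (abs_nonneg _)
        (norm_nonneg _)).trans_eq (mul_one _)
    change ‖(1 / (3 * π)) * ∫ τ in (0 : ℝ)..(6 * π), f.1 τ * cos τ‖ ≤ _
    rw [norm_mul, Real.norm_of_nonneg (by positivity), Real.norm_eq_abs]
    calc _ ≤ 1 / (3 * π) * (‖f‖ * (6 * π)) := by gcongr
      _ = 2 * ‖f‖ := by field_simp; ring

theorem coeff_apply (f : EvenPer) :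
    coeff f = (1 / (3 * π)) * ∫ τ in (0 : ℝ)..(6 * π), f.1 τ * cos τ := rfl

theorem coeff_cosMode : coeff cosMode = 1 := by
  rw [coeff_apply]
  simp only [cosMode_apply, ← pow_two, integral_cos_sq]
  have h := sin_add_period 0
  simp only [zero_add, sin_zero] at h
  rw [h]
  simp
  field_simp
  ring

/-- The source of the term 3a³/4 in the equation for a, and by differentiation of 9a²/4 in the
linearization. -/
theorem coeff_cosMode_cube : coeff (cosMode ^ 3) = 3 / 4 := by
  rw [coeff_apply]
  have : ∀ τ, (cosMode ^ 3).1 τ * cos τ = cos τ ^ 4 := fun τ => by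
    change cos τ ^ 3 * cos τ = _
    ring
  have h := sin_add_period 0
  simp only [zero_add, sin_zero] at h
  simp only [this]
  have h4 := integral_cos_pow (a := 0) (b := 6 * π) 2
  rw [integral_cos_sq, h] at h4
  rw [h4]
  simp
  field_simp
  ring

/-- Duhamel's formula for `w'' + w = g` with vanishing initial data. -/
def duhamel (g : ℝ → ℝ) (τ : ℝ) : ℝ :=
  sin τ * (∫ s in (0 : ℝ)..τ, cos s * g s) - cos τ * ∫ s in (0 : ℝ)..τ, sin s * g s

theorem hasDerivAt_duhamel {g : ℝ → ℝ} (hg : Continuous g) (τ : ℝ) :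
    HasDerivAt (duhamel g) (cos τ * (∫ s in (0 : ℝ)..τ, cos s * g s) +
      sin τ * ∫ s in (0 : ℝ)..τ, sin s * g s) τ := by
  have h1 : HasDerivAt (fun τ => ∫ s in (0 : ℝ)..τ, cos s * g s) (cos τ * g τ) τ :=
    intervalIntegral.integral_hasDerivAt_right (Continuous.intervalIntegrable (by fun_prop) _ _)
      (Continuous.stronglyMeasurableAtFilter (by fun_prop) _ _)
      (Continuous.continuousAt (by fun_prop))
  have h2 : HasDerivAt (fun τ => ∫ s in (0 : ℝ)..τ, sin s * g s) (sin τ * g τ) τ :=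
    intervalIntegral.integral_hasDerivAt_right (Continuous.intervalIntegrable (by fun_prop) _ _)
      (Continuous.stronglyMeasurableAtFilter (by fun_prop) _ _)
      (Continuous.continuousAt (by fun_prop))
  exact (((hasDerivAt_sin τ).mul h1).sub ((hasDerivAt_cos τ).mul h2)).congr_deriv (by ring)

theorem hasDerivAt_duhamel_deriv {g : ℝ → ℝ} (hg : Continuous g) (τ : ℝ) :
    HasDerivAt (fun τ => cos τ * (∫ s in (0 : ℝ)..τ, cos s * g s) +
      sin τ * ∫ s in (0 : ℝ)..τ, sin s * g s) (-duhamel g τ + g τ) τ := by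
  have h1 : HasDerivAt (fun τ => ∫ s in (0 : ℝ)..τ, cos s * g s) (cos τ * g τ) τ :=
    intervalIntegral.integral_hasDerivAt_right (Continuous.intervalIntegrable (by fun_prop) _ _)
      (Continuous.stronglyMeasurableAtFilter (by fun_prop) _ _)
      (Continuous.continuousAt (by fun_prop))
  have h2 : HasDerivAt (fun τ => ∫ s in (0 : ℝ)..τ, sin s * g s) (sin τ * g τ) τ :=
    intervalIntegral.integral_hasDerivAt_right (Continuous.intervalIntegrable (by fun_prop) _ _)
      (Continuous.stronglyMeasurableAtFilter (by fun_prop) _ _)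
      (Continuous.continuousAt (by fun_prop))
  refine (((hasDerivAt_cos τ).mul h1).add ((hasDerivAt_sin τ).mul h2)).congr_deriv ?_
  rw [duhamel]
  linear_combination g τ * sin_sq_add_cos_sq τ

theorem continuous_duhamel {g : ℝ → ℝ} (hg : Continuous g) : Continuous (duhamel g) :=
  continuous_iff_continuousAt.2 fun τ => (hasDerivAt_duhamel hg τ).continuousAt

theorem duhamel_neg {g : ℝ → ℝ} (he : ∀ τ, g (-τ) = g τ) (τ : ℝ) :
    duhamel g (-τ) = duhamel g τ := by
  have h1 : ∫ s in (0 : ℝ)..(-τ), cos s * g s = -∫ s in (0 : ℝ)..τ, cos s * g s := by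
    rw [← intervalIntegral.integral_symm]
    have := intervalIntegral.integral_comp_neg (a := τ) (b := 0) (fun s => cos s * g s)
    simpa [he] using this.symm
  have h2 : ∫ s in (0 : ℝ)..(-τ), sin s * g s = ∫ s in (0 : ℝ)..τ, sin s * g s := by
    have := intervalIntegral.integral_comp_neg (a := 0) (b := τ) (fun s => sin s * g s)
    simp only [he, sin_neg, neg_mul, neg_zero, intervalIntegral.integral_neg] at this
    rw [intervalIntegral.integral_symm, ← this, neg_neg]
  rw [duhamel, duhamel, h1, h2, sin_neg, cos_neg]
  ring

theorem integral_sin_mul_eq_zero {g : ℝ → ℝ} (he : ∀ τ, g (-τ) = g τ)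
    (hp : Function.Periodic g (6 * π)) : ∫ s in (0 : ℝ)..(6 * π), sin s * g s = 0 := by
  have h1 := (sin_add_period.mul hp).intervalIntegral_add_eq 0 (-(3 * π))
  have h2 := intervalIntegral.integral_comp_neg (a := -(3 * π)) (b := 3 * π)
    (fun s => sin s * g s)
  simp only [he, sin_neg, neg_mul, neg_neg, intervalIntegral.integral_neg] at h2
  rw [zero_add, show -(3 * π) + 6 * π = 3 * π by ring] at h1
  simp only [Pi.mul_apply] at h1
  rw [h1]
  linarith

/-- Over one period Duhamel's integrals grow by the cos- and sin-moments of g. The first vanishes by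
assumption, the second by parity, so there is no secular growth. -/
theorem duhamel_periodic {g : ℝ → ℝ} (hg : Continuous g) (he : ∀ τ, g (-τ) = g τ)
    (hp : Function.Periodic g (6 * π)) (h0 : ∫ s in (0 : ℝ)..(6 * π), cos s * g s = 0) :
    Function.Periodic (duhamel g) (6 * π) := fun τ => by
  have h : ∀ f : ℝ → ℝ, Continuous f → Function.Periodic f (6 * π) →
      ∫ s in (0 : ℝ)..(6 * π), f s = 0 →
      ∫ s in (0 : ℝ)..(τ + 6 * π), f s = ∫ s in (0 : ℝ)..τ, f s := fun f hf hfp hf0 => by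
    rw [← intervalIntegral.integral_add_adjacent_intervals (hf.intervalIntegrable 0 τ)
      (hf.intervalIntegrable τ (τ + 6 * π)), hfp.intervalIntegral_add_eq τ 0, zero_add, hf0,
      add_zero]
  rw [duhamel, duhamel, cos_add_period, sin_add_period,
    h (fun s => cos s * g s) (by fun_prop) (cos_add_period.mul hp) h0,
    h (fun s => sin s * g s) (by fun_prop) (sin_add_period.mul hp)
      (integral_sin_mul_eq_zero he hp)]

/-- By periodicity it suffices to bound one period, where each of the two integrals is at most 6πC.
-/
theorem abs_duhamel_le {g : ℝ → ℝ} (hper : Function.Periodic (duhamel g) (6 * π)) {C : ℝ}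
    (hC : ∀ s, |g s| ≤ C) (τ : ℝ) : |duhamel g τ| ≤ 12 * π * C := by
  obtain ⟨t, ⟨ht0, ht1⟩, ht⟩ := hper.exists_mem_Ico₀ (by positivity) τ
  rw [ht, duhamel]
  have h1 : |∫ s in (0 : ℝ)..t, cos s * g s| ≤ C * (6 * π) :=
    abs_integral_le (fun s => by
      rw [abs_mul]
      nlinarith [abs_cos_le_one s, hC s, abs_nonneg (g s)]) ht0 ht1.le
  have h2 : |∫ s in (0 : ℝ)..t, sin s * g s| ≤ C * (6 * π) :=
    abs_integral_le (fun s => by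
      rw [abs_mul]
      nlinarith [abs_sin_le_one s, hC s, abs_nonneg (g s)]) ht0 ht1.le
  refine (abs_sub _ _).trans ?_
  rw [abs_mul, abs_mul]
  have h3 := mul_le_mul (abs_sin_le_one t) h1 (abs_nonneg _) zero_le_one
  have h4 := mul_le_mul (abs_cos_le_one t) h2 (abs_nonneg _) zero_le_one
  linarith

/-- The non-resonant part. -/
def nonres (g : EvenPer) : EvenPer := g - coeff g • cosMode

theorem nonres_apply (g : EvenPer) (τ : ℝ) : (nonres g).1 τ = g.1 τ - coeff g * cos τ := rfl

theorem continuous_coe (g : EvenPer) : Continuous g.1 := g.1.continuous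

theorem nonres_duhamel_periodic (g : EvenPer) :
    Function.Periodic (duhamel (nonres g).1) (6 * π) := by
  refine duhamel_periodic (continuous_coe _) (even _) (periodic _) ?_
  have h : coeff (nonres g) = 0 := by
    simp [nonres, coeff_cosMode]
  rw [coeff_apply] at h
  simp only [mul_comm (cos _)]
  exact (mul_eq_zero.1 h).resolve_left (by positivity)

/-- The solution operator of `w'' + w = nonres g` with vanishing initial data. -/
def duhamelCLM : EvenPer →L[ℝ] EvenPer :=
  LinearMap.mkContinuous
    { toFun := fun g : EvenPer => mk (duhamel (nonres g).1) (continuous_duhamel (continuous_coe _))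
        (duhamel_neg (even _)) (nonres_duhamel_periodic g)
      map_add' := fun f g => by
        refine Subtype.ext (BoundedContinuousFunction.ext fun τ => ?_)
        change duhamel _ τ = duhamel _ τ + duhamel _ τ
        have hf := continuous_coe (nonres f)
        have hg := continuous_coe (nonres g)
        have h : ∀ s, (nonres (f + g)).1 s = (nonres f).1 s + (nonres g).1 s := fun s => by
          simp only [nonres_apply, map_add]
          change f.1 s + g.1 s - _ = _
          ring
        simp only [duhamel, h, mul_add]
        rw [intervalIntegral.integral_add (Continuous.intervalIntegrable (by fun_prop) _ _)
          (Continuous.intervalIntegrable (by fun_prop) _ _),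
          intervalIntegral.integral_add (Continuous.intervalIntegrable (by fun_prop) _ _)
          (Continuous.intervalIntegrable (by fun_prop) _ _)]
        ring
      map_smul' := fun c f => by
        refine Subtype.ext (BoundedContinuousFunction.ext fun τ => ?_)
        change duhamel _ τ = c * duhamel _ τ
        have h : ∀ s, (nonres (c • f)).1 s = c * (nonres f).1 s := fun s => by
          simp only [nonres_apply, map_smul, smul_eq_mul]
          change c * f.1 s - _ = _
          ring
        simp only [duhamel, h, mul_left_comm _ c, intervalIntegral.integral_const_mul]
        ring } (12 * π * (1 + ‖coeff‖ * ‖cosMode‖)) fun g => by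
    have h : ‖nonres g‖ ≤ (1 + ‖coeff‖ * ‖cosMode‖) * ‖g‖ := by
      refine (norm_sub_le _ _).trans ?_
      rw [norm_smul]
      have := mul_le_mul_of_nonneg_right (coeff.le_opNorm g) (norm_nonneg cosMode)
      linarith
    refine norm_le (by positivity) fun τ => (abs_duhamel_le (nonres_duhamel_periodic g)
      (fun s => ((nonres g).abs_apply_le s).trans h) τ).trans_eq (by ring)

/-- The solution operator of `w'' + w = nonres g` without resonant component. -/
def solveNonres : EvenPer →L[ℝ] EvenPer :=
  duhamelCLM - (coeff.smulRight cosMode).comp duhamelCLM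

theorem coeff_solveNonres (g : EvenPer) : coeff (solveNonres g) = 0 := by
  simp [solveNonres, coeff_cosMode]

/-- Solutions of the Lyapunov–Schmidt system solve the differential equation. -/
theorem exists_hasDerivAt {u g : EvenPer} (hg : coeff g = 0)
    (hu : u = coeff u • cosMode + solveNonres g) :
    ∃ u' : ℝ → ℝ, (∀ τ, HasDerivAt u.1 (u' τ) τ) ∧ ∀ τ, HasDerivAt u' (-u.1 τ + g.1 τ) τ := by
  -- `solveNonres` differs from Duhamel's formula by a multiple of cos, which only shifts the free
  -- amplitude.
  obtain ⟨c, hc⟩ : ∃ c, c = coeff u - coeff (duhamelCLM g) := ⟨_, rfl⟩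
  have hn : nonres g = g := by rw [nonres, hg, zero_smul, sub_zero]
  have huf : ∀ τ, u.1 τ = c * cos τ + duhamel g.1 τ := fun τ => by
    have h1 : duhamelCLM (nonres g) = duhamelCLM g := by rw [hn]
    have h2 : (duhamelCLM g).1 τ = duhamel g.1 τ := by
      conv_rhs => rw [← hn]
      rfl
    rw [← h2, hc]
    have h3 : u = (coeff u - coeff (duhamelCLM g)) • cosMode + duhamelCLM g := by
      conv_lhs => rw [hu]
      simp only [solveNonres, sub_apply, ContinuousLinearMap.comp_apply,
        ContinuousLinearMap.smulRight_apply]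
      module
    exact congrArg (fun v : EvenPer => v.1 τ) h3
  refine ⟨fun τ => c * (-sin τ) + (cos τ * (∫ s in (0 : ℝ)..τ, cos s * g.1 s) +
      sin τ * ∫ s in (0 : ℝ)..τ, sin s * g.1 s), fun τ => ?_, fun τ => ?_⟩
  · rw [show (u.1 : ℝ → ℝ) = fun τ => c * cos τ + duhamel g.1 τ from funext huf]
    exact ((hasDerivAt_cos τ).const_mul c).add (hasDerivAt_duhamel (continuous_coe g) τ)
  · refine (((hasDerivAt_sin τ).neg.const_mul c).add
      (hasDerivAt_duhamel_deriv (continuous_coe g) τ)).congr_deriv ?_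
    rw [huf]
    ring

end EvenPer
end

/-! ### Fourier coefficients, H² norms and uniform bounds. -/

noncomputable section

open MeasureTheory Set in
theorem perFourierCoeff_add {f g : ℝ → ℝ} (hf : Continuous f) (hg : Continuous g) (m : ℤ) :
    perFourierCoeff (fun t => f t + g t) m = perFourierCoeff f m + perFourierCoeff g m := by
  simp only [perFourierCoeff, fourierCoeffOn_eq_integral]
  rw [← smul_add, ← intervalIntegral.integral_add]
  · simp only [Complex.ofReal_add, smul_add]
  all_goals
    refine Continuous.intervalIntegrable ?_ _ _
    have := ((map_continuous (fourier (T := 6 * π - 0) (-m))).comp (AddCircle.continuous_mk' _))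
    exact this.smul (by fun_prop)

theorem perFourierCoeff_const_mul (f : ℝ → ℝ) (c : ℝ) (m : ℤ) :
    perFourierCoeff (fun t => c * f t) m = c * perFourierCoeff f m := by
  simp only [perFourierCoeff, Complex.ofReal_mul]
  exact fourierCoeffOn.const_mul _ _ _ _

theorem perFourierCoeff_deriv {f f' : ℝ → ℝ} (hf : ∀ x, HasDerivAt f (f' x) x)
    (hf' : Continuous f') (hp : Function.Periodic f (6 * π)) (m : ℤ) :
    perFourierCoeff f' m = Complex.I * m / 3 * perFourierCoeff f m := by
  -- The mode m = 0 is separate because the formula for integration by parts divides by m.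
  rcases eq_or_ne m 0 with rfl | hm
  · have : ∫ x in (0 : ℝ)..(6 * π), (f' x : ℂ) = 0 := by
      rw [intervalIntegral.integral_ofReal,
        intervalIntegral.integral_eq_sub_of_hasDerivAt (fun x _ => hf x)
        (hf'.intervalIntegrable _ _), show f (6 * π) = f 0 by simpa using hp 0]
      simp
    simp [perFourierCoeff, fourierCoeffOn_eq_integral, this]
  · have := fourierCoeffOn_of_hasDerivAt (a := 0) (b := 6 * π) (by positivity)
      (f := fun t => (f t : ℂ)) (f' := fun t => (f' t : ℂ)) hm
      (fun x _ => (hf x).ofReal_comp)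
      ((Complex.continuous_ofReal.comp hf').intervalIntegrable _ _)
    rw [show f (6 * π) = f 0 by simpa using hp 0, sub_self, mul_zero, zero_sub] at this
    rw [perFourierCoeff, perFourierCoeff, this]
    have hπ : (π : ℂ) ≠ 0 := Complex.ofReal_ne_zero.2 pi_ne_zero
    have hm' : (m : ℂ) ≠ 0 := Int.cast_ne_zero.2 hm
    push_cast
    field_simp
    ring

open MeasureTheory Set in
/-- A periodic `C²` function lies in `H²_per`, with norm controlled by uniform norms. -/
theorem H2perLe_of_hasDerivAt {f f' f'' : ℝ → ℝ} (hf : ∀ x, HasDerivAt f (f' x) x)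
    (hf' : ∀ x, HasDerivAt f' (f'' x) x) (hf'' : Continuous f'')
    (hp : Function.Periodic f (6 * π)) {A B : ℝ} (hA : ∀ x, |f x| ≤ A) (hB : ∀ x, |f'' x| ≤ B) :
    H2perLe f (A + 9 * B) := by
  have hcf : Continuous f := continuous_iff_continuousAt.2 fun x => (hf x).continuousAt
  have hcf' : Continuous f' := continuous_iff_continuousAt.2 fun x => (hf' x).continuousAt
  have hA0 : 0 ≤ A := (abs_nonneg _).trans (hA 0)
  have hB0 : 0 ≤ B := (abs_nonneg _).trans (hB 0)
  have hp' : Function.Periodic f' (6 * π) := fun x => by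
    have h1 := (hf (x + 6 * π)).comp_add_const x (6 * π)
    rw [show (fun x => f (x + 6 * π)) = f from funext hp] at h1
    exact h1.unique (hf x)
  -- The frequencies are m/3, so f − 9f'' has coefficients (1 + m²)c_m. By Parseval the H² norm of f
  -- is the normalized L² norm of g.
  let g : ℝ → ℝ := fun x => f x + (-9) * f'' x
  have hcg : Continuous g := by fun_prop
  have hgc : ∀ m : ℤ, ‖perFourierCoeff g m‖ ^ 2 =
      (1 + (m : ℝ) ^ 2) ^ 2 * ‖perFourierCoeff f m‖ ^ 2 := fun m => by
    rw [show perFourierCoeff g m = ((1 + (m : ℝ) ^ 2 : ℝ) : ℂ) * perFourierCoeff f m by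
      rw [perFourierCoeff_add hcf (by fun_prop), perFourierCoeff_const_mul,
        perFourierCoeff_deriv hf' hf'' hp', perFourierCoeff_deriv hf hcf' hp]
      push_cast
      linear_combination -(m : ℂ) ^ 2 * perFourierCoeff f m * Complex.I_sq]
    rw [norm_mul, Complex.norm_real, Real.norm_of_nonneg (by positivity), mul_pow]
  have hL2 : MemLp (fun t => (g t : ℂ)) 2 (volume.restrict (Ioc 0 (6 * π))) := by
    refine MemLp.of_bound (C := A + 9 * B) (by fun_prop) (Filter.Eventually.of_forall fun x => ?_)
    rw [Complex.norm_real, Real.norm_eq_abs]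
    refine (abs_add_le _ _).trans ?_
    rw [abs_mul, abs_neg]
    norm_num
    linarith [hA x, hB x]
  have hsum := hasSum_sq_fourierCoeffOn (a := 0) (b := 6 * π) (by positivity) hL2
  have hsum' : HasSum (fun m : ℤ => (1 + (m : ℝ) ^ 2) ^ 2 * ‖perFourierCoeff f m‖ ^ 2)
      ((6 * π - 0)⁻¹ • ∫ x in (0 : ℝ)..(6 * π), ‖(g x : ℂ)‖ ^ 2) := by
    convert hsum using 1
    exact funext fun m => (hgc m).symm
  refine ⟨⟨hp, hcf, hsum'.summable⟩, ?_⟩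
  rw [normH2per, hsum'.tsum_eq]
  refine Real.sqrt_le_iff.2 ⟨by positivity, ?_⟩
  have hint : ∫ x in (0 : ℝ)..(6 * π), ‖(g x : ℂ)‖ ^ 2 ≤
      ∫ x in (0 : ℝ)..(6 * π), (A + 9 * B) ^ 2 := by
    refine intervalIntegral.integral_mono_on (by positivity)
      (Continuous.intervalIntegrable (by fun_prop) _ _) (by simp) fun x _ => ?_
    rw [Complex.norm_real, Real.norm_eq_abs]
    have : |g x| ≤ A + 9 * B := by
      refine (abs_add_le _ _).trans ?_
      rw [abs_mul, abs_neg]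
      norm_num
      linarith [hA x, hB x]
    gcongr
  rw [intervalIntegral.integral_const, smul_eq_mul] at hint
  rw [smul_eq_mul, inv_mul_le_iff₀ (by simp [pi_pos])]
  exact hint

theorem MemH2per.add {f g : ℝ → ℝ} (hf : MemH2per f) (hg : MemH2per g) :
    MemH2per fun t => f t + g t := by
  refine ⟨fun x => by simp only [hf.1 x, hg.1 x], hf.2.1.add hg.2.1, ?_⟩
  refine Summable.of_nonneg_of_le (fun m => by positivity) (fun m => ?_)
    ((hf.2.2.mul_left 2).add (hg.2.2.mul_left 2))
  rw [perFourierCoeff_add hf.2.1 hg.2.1]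
  have h1 := norm_add_le (perFourierCoeff f m) (perFourierCoeff g m)
  have h2 : ‖perFourierCoeff f m + perFourierCoeff g m‖ ^ 2 ≤
      2 * ‖perFourierCoeff f m‖ ^ 2 + 2 * ‖perFourierCoeff g m‖ ^ 2 := by
    nlinarith [sq_nonneg (‖perFourierCoeff f m‖ - ‖perFourierCoeff g m‖),
      norm_nonneg (perFourierCoeff f m + perFourierCoeff g m)]
  have h3 : 0 ≤ (1 + (m : ℝ) ^ 2) ^ 2 := by positivity
  nlinarith [mul_le_mul_of_nonneg_left h2 h3]

theorem summable_inv_one_add_sq : Summable fun m : ℤ => (1 + (m : ℝ) ^ 2)⁻¹ := by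
  have h := Real.summable_one_div_int_pow.2 (by norm_num : 1 < 2)
  refine Summable.of_norm_bounded_eventually h ?_
  filter_upwards [(Set.finite_singleton (0 : ℤ)).compl_mem_cofinite] with m hm
  have : (0 : ℝ) < (m : ℝ) ^ 2 := by
    have : (m : ℝ) ≠ 0 := Int.cast_ne_zero.2 hm
    positivity
  rw [Real.norm_of_nonneg (by positivity), one_div]
  gcongr
  linarith

/-- The Sobolev embedding of `H²_per` into the continuous functions. -/
theorem MemH2per.abs_le {f : ℝ → ℝ} (hf : MemH2per f) (x : ℝ) :
    |f x| ≤ (∑' m : ℤ, (1 + (m : ℝ) ^ 2)⁻¹) * normH2per f := by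
  have hT : Fact (0 < 6 * π) := ⟨by positivity⟩
  have hpc : Function.Periodic (fun t => (f t : ℂ)) (6 * π) := fun t => by simp [hf.1 t]
  let F : C(AddCircle (6 * π), ℂ) :=
    ⟨hpc.lift, continuous_coinduced_dom.2 (Complex.continuous_ofReal.comp hf.2.1)⟩
  have hF : ∀ m, fourierCoeff F m = perFourierCoeff f m := fun m => by
    rw [fourierCoeff_eq_intervalIntegral _ _ 0, perFourierCoeff, fourierCoeffOn_eq_integral]
    simp only [zero_add, fourier_coe_apply, sub_zero]
    rfl
  -- One term of the norm series is at most its sum; this makes the Fourier series absolutely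
  -- convergent.
  have hb : ∀ m : ℤ, ‖perFourierCoeff f m‖ ≤ (1 + (m : ℝ) ^ 2)⁻¹ * normH2per f := fun m => by
    rw [← div_eq_inv_mul, le_div_iff₀ (by positivity), normH2per]
    refine Real.le_sqrt_of_sq_le ?_
    have := hf.2.2.le_tsum m fun _ _ => by positivity
    linarith
  have hs : Summable fun m : ℤ => (1 + (m : ℝ) ^ 2)⁻¹ * normH2per f :=
    summable_inv_one_add_sq.mul_right _
  have hsn : Summable fun m => ‖perFourierCoeff f m‖ :=
    hs.of_nonneg_of_le (fun _ => norm_nonneg _) hb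
  have hsF : Summable (fourierCoeff F) := by
    rw [show fourierCoeff F = perFourierCoeff f from funext hF]
    exact hsn.of_norm
  have h1 := has_pointwise_sum_fourier_series_of_summable hsF (x : AddCircle (6 * π))
  have h2 : F (x : AddCircle (6 * π)) = (f x : ℂ) := rfl
  rw [h2] at h1
  rw [← Real.norm_eq_abs, ← Complex.norm_real, ← tsum_mul_right]
  refine h1.norm_le_of_bounded hs.hasSum fun m => ?_
  rw [norm_smul, hF, fourier_apply, Circle.norm_coe, mul_one]
  exact hb m

theorem H2perLe.mono {f : ℝ → ℝ} {A B : ℝ} (h : H2perLe f A) (hAB : A ≤ B) : H2perLe f B :=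
  ⟨h.1, h.2.trans hAB⟩

end

/-! ### From the half-lattice to extensions on ℤ. -/

noncomputable section

/-- The sequence `U` extends `U₀` to a solution of the lattice equation away from the central
site, with the asserted asymptotics, where all remainders are controlled by the constant `C`. -/
def IsExtension (δ a ε : ℝ) (U₀ : ℝ → ℝ) (C : ℝ) (U : ℤ → ℝ → ℝ) : Prop :=
  U 0 = U₀ ∧ MemL2H2e U ∧ (∀ n, U (-n) = U n) ∧ HasExpansion δ a ε C U ∧
    (∀ n : ℤ, n ≠ 0 → KGAt δ ε U n) ∧
    H2perLe (fun τ => 2 * kgGamma δ ε * U 1 τ - kgNu δ a ε * cos τ) (C * ε ^ (5 / 3 : ℝ))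

theorem IsExtension.mono {δ a ε : ℝ} {U₀ : ℝ → ℝ} {C C' : ℝ} {U : ℤ → ℝ → ℝ} (hε : 0 < ε)
    (h : IsExtension δ a ε U₀ C U) (hC : C ≤ C') : IsExtension δ a ε U₀ C' U := by
  obtain ⟨h1, h2, h3, ⟨h4, h5, h6⟩, h7, h8⟩ := h
  have hCε : C * ε ≤ C' * ε := by gcongr
  exact ⟨h1, h2, h3, ⟨fun n hn => (h4 n hn).mono hCε, fun n hn => (h5 n hn).mono hCε,
    fun n hn => (h6 n hn).mono hCε⟩, h7, h8.mono (by gcongr)⟩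

/-- An extension can be selected whose constant is nearly optimal. -/
theorem exists_extension_selection (δ a : ℝ) :
    ∃ S : ℝ → (ℝ → ℝ) → ℤ → ℝ → ℝ, ∀ (ε : ℝ) (U₀ : ℝ → ℝ) (C : ℝ), 0 < ε → 0 < C →
      (∃ U, IsExtension δ a ε U₀ C U) → IsExtension δ a ε U₀ (C + 1) (S ε U₀) := by
  classical
  -- The least admissible integer constant depends on (ε, U₀) alone, yet exceeds any admissible
  -- positive C by at most 1, whatever K produced that C.
  refine ⟨fun ε U₀ => if h : ∃ C : ℕ, ∃ U, IsExtension δ a ε U₀ C U then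
    (Nat.find_spec h).choose else 0, fun ε U₀ C hε hC ⟨U, hU⟩ => ?_⟩
  have hU' : ∃ U, IsExtension δ a ε U₀ (⌈C⌉₊ : ℕ) U := ⟨U, hU.mono hε (Nat.le_ceil C)⟩
  have h : ∃ C : ℕ, ∃ U, IsExtension δ a ε U₀ C U := ⟨_, hU'⟩
  simp only [dif_pos h]
  refine (Nat.find_spec h).choose_spec.mono hε ?_
  have h1 : ((Nat.find h : ℕ) : ℝ) ≤ (⌈C⌉₊ : ℝ) := Nat.cast_le.2 (Nat.find_min' h hU')
  exact h1.trans (Nat.ceil_lt_add_one hC.le).le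

/-- Expansion of the coefficients of the lattice equation in `μ = ε^{1/3}`. -/
theorem exists_kgBeta_kgGamma_expansion (δ : ℝ) :
    ∃ μ₁ M : ℝ, 0 < μ₁ ∧ μ₁ ≤ 1 ∧ 0 ≤ M ∧ ∀ μ ε : ℝ, 0 < μ → μ < μ₁ → ε = μ ^ 3 →
      ε ^ (2 / 3 : ℝ) = μ ^ 2 → ∃ r s : ℝ, |r| ≤ M ∧ |s| ≤ M ∧
        kgBeta δ ε = μ ^ 2 * (2 * δ - 2 * μ + μ ^ 2 * r) ∧
        kgGamma δ ε = μ ^ 2 * (μ + μ ^ 3 * s) := by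
  -- This μ₁ gives |δμ²| ≤ 1/2, so the squared denominator is at least 1/4; hence the factor 4.
  refine ⟨1 / (2 * (|δ| + 1)), 4 * ((2 * |δ| + 2) * (2 * |δ| + δ ^ 2) + δ ^ 2), by positivity, ?_,
    by positivity, fun μ ε hμ hμ' hε hε2 => ?_⟩
  · rw [div_le_one (by positivity)]
    linarith [abs_nonneg δ]
  rw [lt_div_iff₀ (by positivity)] at hμ'
  have hμ1 : μ ≤ 1 := by nlinarith [abs_nonneg δ]
  have hμ2 : μ ^ 2 ≤ μ := by nlinarith
  have hδμ : |δ * μ ^ 2| ≤ 1 / 2 := by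
    rw [abs_mul, abs_of_nonneg (by positivity : 0 ≤ μ ^ 2)]
    nlinarith [abs_nonneg δ]
  have hq : 1 / 2 ≤ 1 + δ * μ ^ 2 := by linarith [(abs_le.1 hδμ).1]
  have hq2 : 1 / 4 ≤ (1 + δ * μ ^ 2) ^ 2 := by nlinarith
  have hq0 : (1 + δ * μ ^ 2) ≠ 0 := by linarith
  have hdiv : ∀ x B : ℝ, |x| ≤ B → |x / (1 + δ * μ ^ 2) ^ 2| ≤ 4 * B := fun x B h => by
    rw [abs_div, abs_of_nonneg (by positivity : 0 ≤ (1 + δ * μ ^ 2) ^ 2),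
      div_le_iff₀ (by positivity)]
    nlinarith [abs_nonneg x]
  have h1 : |2 * δ + δ ^ 2 * μ ^ 2| ≤ 2 * |δ| + δ ^ 2 := by
    refine (abs_add_le _ _).trans ?_
    rw [abs_mul, abs_two, abs_of_nonneg (by positivity : 0 ≤ δ ^ 2 * μ ^ 2)]
    nlinarith [sq_nonneg δ]
  have h2 : |2 * δ - 2 * μ| ≤ 2 * |δ| + 2 := by
    refine (abs_sub _ _).trans ?_
    rw [abs_mul, abs_two, abs_of_nonneg (by positivity : 0 ≤ 2 * μ)]
    linarith
  have hi : ((1 + δ * μ ^ 2) ^ 2)⁻¹ * (1 + δ * μ ^ 2) ^ 2 = 1 := inv_mul_cancel₀ (by positivity)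
  refine ⟨(-((2 * δ - 2 * μ) * (2 * δ + δ ^ 2 * μ ^ 2)) + δ ^ 2) / (1 + δ * μ ^ 2) ^ 2,
    -(2 * δ + δ ^ 2 * μ ^ 2) / (1 + δ * μ ^ 2) ^ 2, hdiv _ _ ?_, ?_, ?_, ?_⟩
  · refine (abs_add_le _ _).trans ?_
    rw [abs_neg, abs_mul, abs_of_nonneg (sq_nonneg δ)]
    gcongr
  · refine (hdiv _ (2 * |δ| + δ ^ 2) (by rwa [abs_neg])).trans ?_
    have : 0 ≤ 2 * |δ| + δ ^ 2 := by positivity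
    nlinarith [abs_nonneg δ, sq_nonneg δ]
  · rw [kgBeta, hε2, hε]
    linear_combination -(1 - 2 * δ * μ ^ 2 + 2 * μ ^ 3) * hi
  · rw [kgGamma, hε2, hε]
    linear_combination μ ^ 3 * hi

theorem contDiff_two_of_hasDerivAt {f f' f'' : ℝ → ℝ} (hf : ∀ x, HasDerivAt f (f' x) x)
    (hf' : ∀ x, HasDerivAt f' (f'' x) x) (hf'' : Continuous f'') :
    ContDiff ℝ 2 f ∧ deriv (deriv f) = f'' := by
  have h1 : deriv f = f' := funext fun x => (hf x).deriv
  have h2 : deriv f' = f'' := funext fun x => (hf' x).deriv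
  refine ⟨?_, by rw [h1, h2]⟩
  rw [show (2 : WithTop ℕ∞) = 1 + 1 by norm_num, contDiff_succ_iff_deriv]
  refine ⟨fun x => (hf x).differentiableAt, by simp, ?_⟩
  rw [h1, contDiff_one_iff_deriv, h2]
  exact ⟨fun x => (hf' x).differentiableAt, hf''⟩

open EvenPer

/-- Since κ cos solves the homogeneous equation, w = u − κ cos satisfies w'' = −w + g, so |w| ≤ B
and |w''| ≤ 2B; the factor is 19 = 1 + 9·2. -/
theorem H2perLe_mul_sub_cos {u g : EvenPer} (hg : coeff g = 0)
    (hu : u = coeff u • cosMode + solveNonres g) {κ B : ℝ} (c : ℝ)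
    (huB : ‖u - κ • cosMode‖ ≤ B) (hgB : ‖g‖ ≤ B) :
    H2perLe (fun τ => c * (u.1 τ - κ * cos τ)) (19 * (|c| * B)) := by
  obtain ⟨u', h1, h2⟩ := exists_hasDerivAt hg hu
  have hb : ∀ x, |u.1 x - κ * cos x| ≤ B := fun x =>
    ((u - κ • cosMode).abs_apply_le x).trans huB
  have hb' : ∀ x, |-(u.1 x - κ * cos x) + g.1 x| ≤ 2 * B := fun x => by
    refine (abs_add_le _ _).trans ?_
    rw [abs_neg]
    linarith [hb x, (g.abs_apply_le x).trans hgB]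
  have hcu := u.continuous_coe
  have hcg := g.continuous_coe
  refine (H2perLe_of_hasDerivAt (f' := fun τ => c * (u' τ - κ * (-sin τ)))
    (f'' := fun τ => c * (-(u.1 τ - κ * cos τ) + g.1 τ)) (A := |c| * B) (B := |c| * (2 * B))
    (fun x => ((h1 x).sub ((hasDerivAt_cos x).const_mul κ)).const_mul c) (fun x => ?_)
    (by fun_prop) (fun x => ?_) (fun x => ?_) (fun x => ?_)).mono (by linarith)
  · refine (((h2 x).sub ((hasDerivAt_sin x).neg.const_mul κ)).const_mul c).congr_deriv ?_
    ring
  · have h := u.periodic x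
    exact congrArg₂ (fun v w => c * (v - κ * w)) h (cos_add_period x)
  · rw [abs_mul]
    exact mul_le_mul_of_nonneg_left (hb x) (abs_nonneg c)
  · rw [abs_mul]
    exact mul_le_mul_of_nonneg_left (hb' x) (abs_nonneg c)

theorem IsOscillation.memH2per {φ : ℝ → ℝ} (hφ : IsOscillation φ) : MemH2per φ := by
  have hc : Continuous φ := hφ.contDiff.continuous
  have hd : Differentiable ℝ φ := hφ.contDiff.differentiable (by norm_num)
  have hd' : Differentiable ℝ (deriv φ) := by
    have h := hφ.contDiff
    rw [show (2 : WithTop ℕ∞) = 1 + 1 by norm_num, contDiff_succ_iff_deriv] at h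
    exact h.2.2.differentiable (by norm_num)
  let f := EvenPer.mk φ hc hφ.even hφ.periodic
  have hf : ∀ x, |φ x| ≤ ‖f‖ := f.abs_apply_le
  refine (H2perLe_of_hasDerivAt (f'' := fun x => -φ x + φ x ^ 3) (B := ‖f‖ + ‖f‖ ^ 3)
    (fun x => (hd x).hasDerivAt) (fun x => ?_) (by fun_prop) hφ.periodic hf (fun x => ?_)).1
  · exact (hd' x).hasDerivAt.congr_deriv (by linarith [hφ.ode x])
  · refine (abs_add_le _ _).trans ?_
    rw [abs_neg, abs_pow]
    have := hf x
    gcongr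

theorem summable_half_pow_natAbs : Summable fun n : ℤ => ((1 / 2 : ℝ) ^ n.natAbs) ^ 2 := by
  have h : Summable fun n : ℕ => ((1 / 2 : ℝ) ^ n) ^ 2 := by
    simp only [← pow_mul, mul_comm _ 2]
    simp only [pow_mul]
    exact summable_geometric_of_lt_one (by norm_num) (by norm_num)
  exact Summable.of_nat_of_neg (by simpa using h) (by simpa using h)

-- Instantiates the half-lattice solution with `EvenPer`, `coeff` and `solveNonres`, then reflects
-- it. The forcing discrepancy is 2γ(U₁ − μa cos): O(μ³) times O(μ²), that is O(ε^{5/3}).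
set_option maxHeartbeats 1000000 in
theorem exists_isExtension (δ a : ℝ) (φ : ℝ → ℝ) (hδ : δ ≠ 0) (hφ : IsOscillation φ)
    (ha : 2 * δ * a + 3 / 4 * a ^ 3 + thirdCoeff φ = 0) (hnd : 8 * δ + 9 * a ^ 2 ≠ 0)
    (K : ℝ) (hK : 0 < K) : ∃ ε₀ C : ℝ, 0 < ε₀ ∧ 0 < C ∧
      ∀ ε : ℝ, 0 < ε → ε < ε₀ → ∀ U₀ : ℝ → ℝ, (∀ τ, U₀ (-τ) = U₀ τ) →
        H2perLe (fun τ => U₀ τ - φ τ) (K * ε ^ (2 / 3 : ℝ)) →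
        ∃ U, IsExtension δ a ε U₀ C U := by
  obtain ⟨μ₁, M₁, hμ₁, hμ₁1, hM₁, hpar⟩ := exists_kgBeta_kgGamma_expansion δ
  have hφc : Continuous φ := hφ.contDiff.continuous
  let f : EvenPer := EvenPer.mk φ hφc hφ.even hφ.periodic
  obtain ⟨S, hS⟩ : ∃ S : ℝ, S = ∑' m : ℤ, (1 + (m : ℝ) ^ 2)⁻¹ := ⟨_, rfl⟩
  have hS0 : 0 ≤ S := by rw [hS]; exact tsum_nonneg fun m => by positivity
  obtain ⟨M, hM⟩ : ∃ M, M = M₁ + ‖f‖ + S * K + ‖coeff‖ * (S * K) := ⟨_, rfl⟩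
  have hM0 : 0 ≤ M := by rw [hM]; positivity
  have hMM₁ : M₁ ≤ M := by rw [hM, add_assoc, add_assoc]; exact le_add_of_nonneg_right (by positivity)
  obtain ⟨μ₀, C, hμ₀, hC, hsol⟩ := exists_halfLattice_solution cosMode coeff solveNonres
    coeff_cosMode coeff_cosMode_cube coeff_solveNonres hδ hnd ha M hM0
  obtain ⟨b, hb⟩ : ∃ b, b = 8 * a / (8 * δ + 9 * a ^ 2) := ⟨_, rfl⟩
  refine ⟨(min μ₀ μ₁) ^ 3, 19 * C + 19 * (2 * (1 + M) * (C + |b| * ‖cosMode‖)), by positivity,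
    by positivity, fun ε hε hε₀ U₀ heven hU₀ => ?_⟩
  obtain ⟨μ, hμdef⟩ : ∃ μ, μ = ε ^ (1 / 3 : ℝ) := ⟨_, rfl⟩
  have hμ : 0 < μ := by rw [hμdef]; positivity
  have hpow : ∀ n : ℕ, μ ^ n = ε ^ ((n : ℝ) / 3) := fun n => by
    rw [hμdef, ← rpow_natCast, ← rpow_mul hε.le]
    congr 1
    ring
  have hε3 : ε = μ ^ 3 := by rw [hpow]; norm_num
  have hε2 : ε ^ (2 / 3 : ℝ) = μ ^ 2 := by rw [hpow]; norm_num
  have hε5 : ε ^ (5 / 3 : ℝ) = μ ^ 5 := by rw [hpow]; norm_num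
  have hμlt : μ < min μ₀ μ₁ := by
    rw [hε3] at hε₀
    exact lt_of_pow_lt_pow_left₀ 3 (by positivity) hε₀
  have hμ1 : μ ≤ 1 := (hμlt.le.trans (min_le_right _ _)).trans hμ₁1
  obtain ⟨r, s, hr, hs, hβ, hγ⟩ := hpar μ ε hμ (hμlt.trans_le (min_le_right _ _)) hε3 hε2
  have hdiff : ∀ τ, |U₀ τ - φ τ| ≤ S * K * μ ^ 2 := fun τ => by
    have h1 := hU₀.1.abs_le τ
    rw [← hS] at h1
    have h2 := hU₀.2
    rw [hε2] at h2
    calc _ ≤ _ := h1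
      _ ≤ S * (K * μ ^ 2) := by gcongr
      _ = _ := by ring
  have hU₀mem : MemH2per U₀ := by
    have := hU₀.1.add hφ.memH2per
    simpa using this
  let u₀ : EvenPer := EvenPer.mk U₀ hU₀mem.2.1 heven hU₀mem.1
  have hsub : ‖u₀ - f‖ ≤ S * K * μ ^ 2 := EvenPer.norm_le (by positivity) hdiff
  have hsub1 : ‖u₀ - f‖ ≤ S * K := hsub.trans
    (mul_le_of_le_one_right (by positivity) (pow_le_one₀ hμ.le hμ1))
  have hu₀ : ‖u₀‖ ≤ M := by
    have h1 := norm_le_norm_add_norm_sub f u₀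
    rw [norm_sub_rev] at h1
    have h2 : 0 ≤ ‖coeff‖ * (S * K) := by positivity
    linarith
  have hcoeff : coeff f = thirdCoeff φ := rfl
  -- This quotient is the parameter t: closeness to φ of order ε^{2/3} = μ² is exactly what keeps it
  -- bounded.
  have ht : |(coeff u₀ - thirdCoeff φ) / μ ^ 2| ≤ M := by
    rw [abs_div, abs_of_pos (by positivity : 0 < μ ^ 2), div_le_iff₀ (by positivity), ← hcoeff,
      ← map_sub]
    have h1 : |coeff (u₀ - f)| ≤ ‖coeff‖ * (S * K * μ ^ 2) := coeff.le_opNorm_of_le hsub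
    refine h1.trans ?_
    rw [← mul_assoc]
    gcongr
    have : 0 ≤ S * K := by positivity
    linarith [norm_nonneg f]
  obtain ⟨u, hu0, hu⟩ := hsol μ r s _ hμ (hμlt.trans_le (min_le_left _ _)) (hr.trans hMM₁)
    (hs.trans hMM₁) ht u₀ hu₀ (by field_simp; ring)
  rw [← hβ, ← hγ] at hu
  have happrox : ∀ n : ℕ, n ≠ 0 → approxSol δ a μ cosMode u₀ n =
      (μ * amp a n + μ ^ 2 * ampCorr δ a n) • cosMode := fun n hn => if_neg hn
  have hexp : ∀ n : ℕ, n ≠ 0 →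
      H2perLe (fun τ => (u n).1 τ - (μ * amp a n + μ ^ 2 * ampCorr δ a n) * cos τ)
        (19 * (C * (μ ^ 3 * (1 / 2) ^ n))) := fun n hn => by
    obtain ⟨h1, h2, h3, h4⟩ := hu n hn
    rw [happrox n hn] at h1
    simpa using H2perLe_mul_sub_cos h3 h4 1 h1 h2
  have hexp' : ∀ n : ℕ, n ≠ 0 →
      H2perLe (fun τ => (u n).1 τ - (μ * amp a n + μ ^ 2 * ampCorr δ a n) * cos τ)
        ((19 * C + 19 * (2 * (1 + M) * (C + |b| * ‖cosMode‖))) * ε) := fun n hn => by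
    refine (hexp n hn).mono ?_
    have h1 : (1 / 2 : ℝ) ^ n ≤ 1 := pow_le_one₀ (by norm_num) (by norm_num)
    have h2 : 0 ≤ 19 * (2 * (1 + M) * (C + |b| * ‖cosMode‖)) := by positivity
    calc _ ≤ 19 * (C * (μ ^ 3 * 1)) := by gcongr
      _ = 19 * C * ε := by rw [hε3]; ring
      _ ≤ _ := by gcongr; linarith
  have hmem : ∀ n : ℕ, MemH2per (u n).1 := fun n => by
    rcases eq_or_ne n 0 with rfl | hn
    · rw [hu0]; exact hU₀mem
    · obtain ⟨_, _, h3, h4⟩ := hu n hn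
      simpa using (H2perLe_mul_sub_cos h3 h4 (κ := 0) 1 (le_max_left _ _) (le_max_right _ _)).1
  have htail : ∀ n : ℕ, 3 ≤ n → μ * amp a n + μ ^ 2 * ampCorr δ a n = 0 := fun n hn => by
    rw [amp, ampCorr, if_neg (by omega), if_neg (by omega), if_neg (by omega)]
    ring
  -- The even reflection of the half-lattice solution.
  obtain ⟨W, hW⟩ : ∃ W : ℤ → ℝ → ℝ, ∀ (n : ℤ) (k : ℕ), n.natAbs = k → W n = (u k).1 :=
    ⟨fun n => (u n.natAbs).1, by rintro n _ rfl; rfl⟩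
  refine ⟨W, ?_, ⟨fun n => ?_, fun n => ?_, ?_⟩, fun n => ?_, ⟨fun n hn => ?_, fun n hn => ?_,
    fun n hn => ?_⟩, fun n hn => ?_, ?_⟩
  · rw [hW 0 0 rfl, hu0]; rfl
  · rw [hW n _ rfl]; exact hmem _
  · rw [hW n _ rfl]; exact (u n.natAbs).even
  · refine Summable.of_norm_bounded_eventually
      (summable_half_pow_natAbs.mul_left ((19 * C * μ ^ 3) ^ 2)) ?_
    filter_upwards [(Set.finite_Icc (-2 : ℤ) 2).compl_mem_cofinite] with n hn
    have hn3 : 3 ≤ n.natAbs := by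
      simp only [Set.mem_compl_iff, Set.mem_Icc] at hn
      omega
    have h := (hexp n.natAbs (by omega)).2
    simp only [htail _ hn3, zero_mul, sub_zero] at h
    rw [← hW n _ rfl] at h
    have h0 : 0 ≤ normH2per (W n) := Real.sqrt_nonneg _
    rw [Real.norm_of_nonneg (by positivity), ← mul_pow]
    gcongr
    linarith
  · rw [hW _ _ (Int.natAbs_neg n), hW n _ rfl]
  · rw [Int.abs_eq_natAbs] at hn
    rw [hW n 1 (by omega), ← hμdef, hε2]
    convert hexp' 1 one_ne_zero using 3
    simp only [amp, ampCorr, if_true]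
    ring
  · rw [Int.abs_eq_natAbs] at hn
    rw [hW n 2 (by omega), hε2]
    convert hexp' 2 two_ne_zero using 3
    simp only [amp, ampCorr, if_true, OfNat.ofNat_ne_one, if_false]
    ring
  · rw [Int.abs_eq_natAbs] at hn
    have h := hexp' n.natAbs (by omega)
    simp only [htail n.natAbs (by omega), zero_mul, sub_zero] at h
    rw [hW n _ rfl]
    exact h
  · obtain ⟨k, hk⟩ : ∃ k, n.natAbs = k := ⟨_, rfl⟩
    obtain ⟨h1, h2, h3, h4⟩ := hu k (by omega)
    obtain ⟨u', hd1, hd2⟩ := exists_hasDerivAt h3 h4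
    have hcu := (u k).continuous_coe
    have hcg := (siteForce (kgBeta δ ε) (kgGamma δ ε) u k).continuous_coe
    obtain ⟨hcd, hdd⟩ := contDiff_two_of_hasDerivAt hd1 hd2 (by fun_prop)
    rw [KGAt, hW n k hk]
    refine ⟨hcd, fun τ => ?_⟩
    have hdd' : deriv (deriv (u k).1) τ =
      -(u k).1 τ + (siteForce (kgBeta δ ε) (kgGamma δ ε) u k).1 τ := congrFun hdd τ
    have hf : (siteForce (kgBeta δ ε) (kgGamma δ ε) u k).1 τ =
      kgBeta δ ε * (u k).1 τ + (u k).1 τ ^ 3 +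
        kgGamma δ ε * ((u (k + 1)).1 τ + (u (k - 1)).1 τ) := rfl
    -- For n < 0 the reflection exchanges the two neighbours, and the coupling is symmetric in them.
    rcases lt_or_gt_of_ne hn with hneg | hpos
    · rw [hW (n + 1) (k - 1) (by omega), hW (n - 1) (k + 1) (by omega)]
      linear_combination hdd' + hf
    · rw [hW (n + 1) (k + 1) (by omega), hW (n - 1) (k - 1) (by omega)]
      linear_combination hdd' + hf
  · obtain ⟨h1, h2, h3, h4⟩ := hu 1 one_ne_zero
    have hp : μ ^ 3 * (1 / 2) ^ 1 ≤ μ ^ 2 := by nlinarith [pow_pos hμ 2]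
    have hB : ‖u 1 - (μ * a) • cosMode‖ ≤ (C + |b| * ‖cosMode‖) * μ ^ 2 := by
      have e : u 1 - (μ * a) • cosMode =
          (u 1 - approxSol δ a μ cosMode u₀ 1) + (μ ^ 2 * b) • cosMode := by
        rw [happrox 1 one_ne_zero, hb]
        simp only [amp, ampCorr, if_true]
        module
      rw [e]
      refine (norm_add_le _ _).trans ?_
      rw [norm_smul, Real.norm_eq_abs, abs_mul, abs_of_pos (by positivity : 0 < μ ^ 2)]
      have := h1.trans (mul_le_mul_of_nonneg_left hp hC.le)
      linarith
    have hG : ‖siteForce (kgBeta δ ε) (kgGamma δ ε) u 1‖ ≤ (C + |b| * ‖cosMode‖) * μ ^ 2 := by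
      have h5 := h2.trans (mul_le_mul_of_nonneg_left hp hC.le)
      have h6 : 0 ≤ |b| * ‖cosMode‖ * μ ^ 2 := by positivity
      linarith
    have h := H2perLe_mul_sub_cos h3 h4 (2 * kgGamma δ ε) hB hG
    have hfun : (fun τ => 2 * kgGamma δ ε * W 1 τ - kgNu δ a ε * cos τ) =
        fun τ => 2 * kgGamma δ ε * ((u 1).1 τ - μ * a * cos τ) := by
      funext τ
      rw [kgNu, ← hμdef, hW 1 1 rfl]
      ring
    rw [hfun]
    refine h.mono ?_
    have hγb : |2 * kgGamma δ ε| ≤ 2 * (1 + M) * μ ^ 3 := by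
      rw [hγ, show 2 * (μ ^ 2 * (μ + μ ^ 3 * s)) = 2 * (1 + μ ^ 2 * s) * μ ^ 3 by ring, abs_mul,
        abs_mul, abs_two, abs_of_pos (by positivity : 0 < μ ^ 3)]
      gcongr
      refine (abs_add_le _ _).trans ?_
      rw [abs_one, abs_mul, abs_of_pos (by positivity : 0 < μ ^ 2)]
      have := mul_le_mul (pow_le_one₀ hμ.le hμ1 (n := 2)) (hs.trans hMM₁) (abs_nonneg s)
        zero_le_one
      linarith
    rw [hε5]
    have h7 : 0 ≤ 19 * C * μ ^ 5 := by positivity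
    calc 19 * (|2 * kgGamma δ ε| * ((C + |b| * ‖cosMode‖) * μ ^ 2))
        ≤ 19 * (2 * (1 + M) * μ ^ 3 * ((C + |b| * ‖cosMode‖) * μ ^ 2)) := by gcongr
      _ = 19 * (2 * (1 + M) * (C + |b| * ‖cosMode‖)) * μ ^ 5 := by ring
      _ ≤ _ := by linarith

end

/-! ### The main theorem. -/

theorem mainTheorem6 (δ a : ℝ) (φ : ℝ → ℝ) (hδ : δ ≠ 0) (hφ : IsOscillation φ)
    (hc : thirdCoeff φ ≠ 0)
    (ha : 2 * δ * a + 3 / 4 * a ^ 3 + thirdCoeff φ = 0)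
    (hnd : 8 * δ + 9 * a ^ 2 ≠ 0) :
    ∃ R : ℝ → (ℝ → ℝ) → ℝ → ℝ, ∀ K : ℝ, 0 < K → ∃ ε₀ C : ℝ, 0 < ε₀ ∧ 0 < C ∧
      ∀ ε : ℝ, 0 < ε → ε < ε₀ → ∀ U₀ : ℝ → ℝ, IsSymmetric U₀ →
        H2perLe (fun τ => U₀ τ - φ τ) (K * ε ^ (2 / 3 : ℝ)) →
        H2perLe (R ε U₀) (C * ε ^ (5 / 3 : ℝ)) ∧
        ∃ U : ℤ → ℝ → ℝ, U 0 = U₀ ∧ MemL2H2e U ∧ (∀ n, U (-n) = U n) ∧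
          HasExpansion δ a ε C U ∧
          (∀ n : ℤ, n ≠ 0 → KGAt δ ε U n) ∧
          (∀ τ, 2 * kgGamma δ ε * U 1 τ = kgNu δ a ε * cos τ + R ε U₀ τ) ∧
          (SolvesDuffing δ a ε (R ε U₀) U₀ ↔ IsKGSolution δ ε U) := by
  obtain ⟨S, hS⟩ := exists_extension_selection δ a
  refine ⟨fun ε U₀ τ => 2 * kgGamma δ ε * S ε U₀ 1 τ - kgNu δ a ε * cos τ, fun K hK => ?_⟩
  obtain ⟨ε₀, C, hε₀, hC, h⟩ := exists_isExtension δ a φ hδ hφ ha hnd K hK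
  refine ⟨ε₀, C + 1, hε₀, by positivity, fun ε hε hεlt U₀ hsymm hU₀ => ?_⟩
  obtain ⟨h0, h1, h2, h3, h4, h5⟩ :=
    hS ε U₀ C hε hC (h ε hε hεlt U₀ (fun τ => (hsymm τ).1) hU₀)
  refine ⟨h5, S ε U₀, h0, h1, h2, h3, h4, fun τ => by ring, ?_⟩
  have hneg : S ε U₀ (0 - 1) = S ε U₀ 1 := by simpa using h2 1
  -- Since U₋₁ = U₁, the coupling at site 0 is 2γU₁ = ν cos τ + R by the choice of R.
  have hzero : KGAt δ ε (S ε U₀) 0 ↔ SolvesDuffing δ a ε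
      (fun τ => 2 * kgGamma δ ε * S ε U₀ 1 τ - kgNu δ a ε * cos τ) U₀ := by
    rw [KGAt, SolvesDuffing, hneg, h0, zero_add]
    refine and_congr_right fun _ => forall_congr' fun τ => ?_
    rw [show kgBeta δ ε * U₀ τ + kgGamma δ ε * (S ε U₀ 1 τ + S ε U₀ 1 τ) =
      kgBeta δ ε * U₀ τ + kgNu δ a ε * cos τ +
        (2 * kgGamma δ ε * S ε U₀ 1 τ - kgNu δ a ε * cos τ) by ring]
  refine ⟨fun hd n => ?_, fun hk => hzero.1 (hk 0)⟩
  rcases eq_or_ne n 0 with rfl | hn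
  · exact hzero.2 hd
  · exact h4 n hn
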